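/- For an integer $\epsilon\ge 1$ let $H(\epsilon)=\left\lfloor \frac{7+\sqrt{24\epsilon+1}}{2}\right\rfloor$. **Proposition 3.3.** Let $\epsilon\ge 1$ be an integer with $\epsilon\ne\frac{3i^2+3i}{2}$ for every integer $i\ge 1$. Let $G$ be a finite simple graph embedded (not necessarily cellularly) on a closed connected surface $S$, orientable or not, of Euler genus $\epsilon=2-\chi(S)$. Let $F$ be a face of the embedding, i.e. a connected component of $S\setminus G$, and let $V(F)$ be the set of vertices of $G$ on the boundary of $F$. Let every vertex $v$ of $G$ have a finite list $L(v)$ of colors such that $|L(v)|\ge H(\epsilon)-2$ if $v\in V(F)$ and $|L(v)|\ge H(\epsilon)$ if $v\notin V(F)$. Then $G$ is $L$-list-colorable, i.e. it has a proper coloring in which each vertex $v$ receives a color from $L(v)$, unless $G$ contains a complete graph $K_{H(\epsilon)-1}$ all of whose vertices lie in $V(F)$. Here, as usual for graphs on surfaces, an embedding is given combinatorially: $S$ is presented by a finite cell decomposition (polygons glued along their sides) whose 1-skeleton contains $G$ as a subgraph; the decomposition may have further vertices and edges. -/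

import Mathlib

/-- The Heawood number `H(ε) = ⌊(7 + √(24 ε + 1)) / 2⌋`. -/
noncomputable def heawood (ε : ℕ) : ℕ :=
  ⌊(7 + Real.sqrt (24 * (ε : ℝ) + 1)) / 2⌋₊

/-- A closed connected surface, glued from finitely many polygons (a finite cell decomposition).

`Φ` is the set of flags, i.e. of triangles of the barycentric subdivision; such a triangle has one
corner at a vertex, one at the midpoint of an edge and one at the centre of a polygon. Each triangle
`x` is glued along its three sides to the three *adjacent* triangles
* `flipVertex x`: same edge, same polygon, other end of the edge,
* `flipEdge x`: same vertex, same polygon, the other edge of the polygon at this corner,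
* `flipFace x`: same vertex, same edge, other side of the edge.

The surface may be orientable or not; loops, multiple edges, vertices of degree one and polygons
with one or two sides are allowed in the decomposition. -/
structure CellSurface (Φ : Type*) where
  finite_flags : Finite Φ
  nonempty_flags : Nonempty Φ
  flipVertex : Φ → Φ
  flipEdge : Φ → Φ
  flipFace : Φ → Φ
  flipVertex_flipVertex : ∀ x, flipVertex (flipVertex x) = x
  flipEdge_flipEdge : ∀ x, flipEdge (flipEdge x) = x
  flipFace_flipFace : ∀ x, flipFace (flipFace x) = x
  flipVertex_ne : ∀ x, flipVertex x ≠ x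
  flipEdge_ne : ∀ x, flipEdge x ≠ x
  flipFace_ne : ∀ x, flipFace x ≠ x
  /-- Around the midpoint of an edge there are exactly four triangles. -/
  flip_comm : ∀ x, flipVertex (flipFace x) = flipFace (flipVertex x)
  flipVertex_ne_flipFace : ∀ x, flipVertex x ≠ flipFace x
  /-- The surface is connected. -/
  connected : ∀ x y, Relation.EqvGen
    (fun a b => b = flipVertex a ∨ b = flipEdge a ∨ b = flipFace a) x y

namespace CellSurface

variable {Φ : Type*} (S : CellSurface Φ)

/-- Two flags have the same vertex. -/
def vertexSetoid : Setoid Φ :=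
  Relation.EqvGen.setoid fun x y => y = S.flipEdge x ∨ y = S.flipFace x

/-- Two flags have the same edge. -/
def edgeSetoid : Setoid Φ :=
  Relation.EqvGen.setoid fun x y => y = S.flipVertex x ∨ y = S.flipFace x

/-- Two flags have the same polygon. -/
def polygonSetoid : Setoid Φ :=
  Relation.EqvGen.setoid fun x y => y = S.flipVertex x ∨ y = S.flipEdge x

/-- The vertices (0-cells) of the decomposition. -/
def Vertex : Type _ := Quotient S.vertexSetoid

/-- The edges (1-cells) of the decomposition. -/
def Edge : Type _ := Quotient S.edgeSetoid

/-- The polygons (2-cells) of the decomposition. -/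
def Polygon : Type _ := Quotient S.polygonSetoid

/-- The vertex of a flag. -/
def vertexOf (x : Φ) : S.Vertex := Quotient.mk S.vertexSetoid x

/-- The edge of a flag. -/
def edgeOf (x : Φ) : S.Edge := Quotient.mk S.edgeSetoid x

/-- The Euler characteristic of the surface. -/
noncomputable def eulerChar : ℤ :=
  (Nat.card S.Vertex : ℤ) - (Nat.card S.Edge : ℤ) + (Nat.card S.Polygon : ℤ)

/-- The Euler genus `2 - χ(S)` of the surface: `2 g` for the sphere with `g` handles and `k` for the
sphere with `k` crosscaps. -/
noncomputable def eulerGenus : ℤ := 2 - S.eulerChar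

end CellSurface

/-- An embedding of a graph `G` on the surface `S`: distinct vertices of `G` are drawn as distinct
vertices of `S`, and an edge `uv` of `G` is drawn as an edge of `S` that joins the points `u` and
`v`. The decomposition of `S` may have further vertices and edges, which do not belong to the drawing
of `G`; hence the embedding of `G` need not be cellular and `G` need not be connected. -/
structure SurfaceEmbedding {V Φ : Type*} (G : SimpleGraph V) (S : CellSurface Φ) where
  vert : V ↪ S.Vertex
  edge : G.edgeSet ↪ S.Edge
  ends : ∀ (e : G.edgeSet) (x : Φ), S.edgeOf x = edge e →
    s(S.vertexOf x, S.vertexOf (S.flipVertex x)) = Sym2.map vert e.1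

namespace SurfaceEmbedding

variable {V Φ : Type*} {G : SimpleGraph V} {S : CellSurface Φ} (E : SurfaceEmbedding G S)

/-- Two flags lie in the same connected component of the complement of `G` in `S`: one can walk from
one triangle to the other through sides of triangles, never crossing an edge of `G`. The sides
crossed by `flipVertex` and `flipEdge` are interior to a polygon; the side crossed by `flipFace` is
half of an edge of `S`. (A vertex of `S` outside `G` has only edges outside `G` around it, so passing
through it would give nothing new.) -/
def faceSetoid : Setoid Φ :=
  Relation.EqvGen.setoid fun x y =>
    y = S.flipVertex x ∨ y = S.flipEdge x ∨ (y = S.flipFace x ∧ S.edgeOf x ∉ Set.range E.edge)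

/-- The faces of the embedding: the connected components of the complement of `G` in `S`. -/
def Face : Type _ := Quotient E.faceSetoid

/-- The face of the embedding that contains (the interior of) a given flag. -/
def faceOf (x : Φ) : E.Face := Quotient.mk E.faceSetoid x

/-- `V(F)`: the vertices of `G` that lie on (the boundary of) the face `F`. -/
def faceVerts (F : E.Face) : Set V :=
  {v | ∃ x : Φ, E.faceOf x = F ∧ S.vertexOf x = E.vert v}

end SurfaceEmbedding

/-- `G` is `L`-list-colorable: there is a proper coloring that gives each vertex `v` a color from
its list `L v`. -/
def ListColorable {V C : Type*} (G : SimpleGraph V) (L : V → Finset C) : Prop :=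
  ∃ c : G.Coloring C, ∀ v, c v ∈ L v

/-! Take a minimal vertex set that cannot be coloured and keep only the subgraph it induces, still
drawn on `S`. Fix a flag in `F`. Deleting edges only enlarges the complementary region around that
flag, so the surviving vertices of `V(F)` still lie on one face. By minimality the graph is
connected and no list is larger than the degree of its vertex. Write `n` for its number of vertices
and `H` for the Heawood number.

If `n ≤ H`, every vertex has a short list, since a list of `H` colours would need degree `H`. For `n
= H - 1` the graph is the excluded clique. For `n = H` its complement is a matching, with at least
two edges because there is no `K_{H-1}`, and Hall's theorem gives a colouring from lists of size `H
- 2` (`listColorableOn_of_card_eq_add_two`).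

If `n > H`, the list sizes give `H n ≤ 2 (e + f)`, where `e` counts the edges and `f` the vertices
on the face. Euler's inequality, applied as if an apex in that face were joined to all `f` vertices,
gives `2 (e + f) ≤ 6 n - 6 + 6 ε` (`card_edges_add_card_faceVerts_le`). Outside the special genera
`6 ε ≤ H (H - 5)` (`le_heawood_mul`), and then `n ≥ H + 1` forces equality throughout.

Equality is still to be excluded. All other faces are then triangles and the distinguished face
passes each of its vertices once, so the neighbours of every vertex induce a connected graph
(`exists_adj_between_neighbors_of_tight`). Hence no vertex is a cut vertex. Moreover every list is
as large as the degree, and the graph is not complete. Two nonadjacent neighbours `a`, `b` of some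
`z` can be removed without disconnecting the rest. Colouring one or both of them so that `z` gains a
spare colour, and the rest greedily towards `z`, contradicts uncolourability. -/

/-! ### Parity and equivalence closures -/

theorem Finset.even_card_of_involution {α : Type*} (s : Finset α) (g : α → α)
    (hmem : ∀ x ∈ s, g x ∈ s) (hne : ∀ x ∈ s, g x ≠ x) (hinv : ∀ x ∈ s, g (g x) = x) :
    Even s.card := by
  have h : ∑ _x ∈ s, (1 : ZMod 2) = 0 :=
    Finset.sum_involution (fun x _ => g x) (fun _ _ => by decide) (fun x hx _ => hne x hx)
      hmem hinv
  rw [Finset.sum_const, nsmul_eq_mul, mul_one] at h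
  exact (ZMod.natCast_eq_zero_iff_even).1 h

theorem Relation.EqvGen.iff_of_step {α : Type*} {r : α → α → Prop} {Q : α → Prop}
    (h : ∀ a b, r a b → (Q a ↔ Q b)) {x y : α} (hxy : Relation.EqvGen r x y) : Q x ↔ Q y := by
  induction hxy with
  | rel a b hab => exact h a b hab
  | refl => rfl
  | symm _ _ _ ih => exact ih.symm
  | trans _ _ _ _ _ ih₁ ih₂ => exact ih₁.trans ih₂

theorem Relation.EqvGen.mono_of_step {α : Type*} {r : α → α → Prop} {s : Setoid α}
    (h : ∀ a b, r a b → s a b) {x y : α} (hxy : Relation.EqvGen r x y) : s x y := by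
  induction hxy with
  | rel a b hab => exact h a b hab
  | refl => exact s.refl _
  | symm _ _ _ ih => exact s.symm ih
  | trans _ _ _ _ _ ih₁ ih₂ => exact s.trans ih₁ ih₂

/-- Identifying two points loses at most one class. -/
theorem Setoid.card_quotient_le_add_one {α : Type*} [Finite α] (r r' : Setoid α) (a b : α)
    (h : ∀ s : Setoid α, r ≤ s → s a b → r' ≤ s) :
    Nat.card (Quotient r) ≤ Nat.card (Quotient r') + 1 := by
  classical
  let s : Setoid α :=
    { r := fun x y => r x y ∨ ((r x a ∨ r x b) ∧ (r y a ∨ r y b))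
      iseqv :=
        { refl := fun x => Or.inl (r.refl x)
          symm := by
            rintro x y (hxy | ⟨hx, hy⟩)
            · exact Or.inl (r.symm hxy)
            · exact Or.inr ⟨hy, hx⟩
          trans := by
            rintro x y z (hxy | ⟨hx, hy⟩) (hyz | ⟨hy', hz⟩)
            · exact Or.inl (r.trans hxy hyz)
            · exact Or.inr ⟨hy'.imp (r.trans hxy) (r.trans hxy), hz⟩
            · exact Or.inr ⟨hx, hy.imp (r.trans (r.symm hyz)) (r.trans (r.symm hyz))⟩
            · exact Or.inr ⟨hx, hz⟩ } }
  have hs : r' ≤ s := h s (fun x y hxy => Or.inl hxy)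
    (Or.inr ⟨Or.inl (r.refl a), Or.inr (r.refl b)⟩)
  -- `s` merges only the classes of `a` and `b`. Sending the class of `b` to `none` leaves no two
  -- classes that `r'` could merge.
  let φ : Quotient r → Option (Quotient r') := fun q =>
    if q = Quotient.mk r b then none else some (Quotient.mk r' q.out)
  have hφ : Function.Injective φ := by
    intro p q hpq
    simp only [φ] at hpq
    split_ifs at hpq with hp hq hq
    · rw [hp, hq]
    · have hnb : ∀ t : Quotient r, t ≠ Quotient.mk r b → ¬ r t.out b := by
        intro t ht hrt
        exact ht (by rw [← Quotient.out_eq t]; exact Quotient.sound hrt)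
      have h1 : r' p.out q.out := Quotient.exact (Option.some.inj hpq)
      have h2 : r p.out q.out := by
        rcases hs h1 with h2 | ⟨h2, h3⟩
        · exact h2
        · exact r.trans (h2.resolve_right (hnb p hp)) (r.symm (h3.resolve_right (hnb q hq)))
      rw [← Quotient.out_eq p, ← Quotient.out_eq q]
      exact Quotient.sound h2
  have := Nat.card_le_card_of_injective φ hφ
  rwa [Finite.card_option] at this

/-! ### Flags, corners and regions of a cell surface -/

namespace CellSurface

variable {Φ : Type*} (S : CellSurface Φ)

@[simp] theorem edgeOf_flipVertex (x : Φ) : S.edgeOf (S.flipVertex x) = S.edgeOf x :=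
  Quotient.sound (.symm _ _ (.rel _ _ (Or.inl rfl)))

@[simp] theorem edgeOf_flipFace (x : Φ) : S.edgeOf (S.flipFace x) = S.edgeOf x :=
  Quotient.sound (.symm _ _ (.rel _ _ (Or.inr rfl)))

@[simp] theorem vertexOf_flipEdge (x : Φ) : S.vertexOf (S.flipEdge x) = S.vertexOf x :=
  Quotient.sound (.symm _ _ (.rel _ _ (Or.inl rfl)))

@[simp] theorem vertexOf_flipFace (x : Φ) : S.vertexOf (S.flipFace x) = S.vertexOf x :=
  Quotient.sound (.symm _ _ (.rel _ _ (Or.inr rfl)))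

@[simp] theorem vertexOf_flipVertex_flipFace (x : Φ) :
    S.vertexOf (S.flipVertex (S.flipFace x)) = S.vertexOf (S.flipVertex x) := by
  rw [S.flip_comm, vertexOf_flipFace]

/-- The four flags of an edge. -/
theorem edgeOf_eq_iff (x y : Φ) : S.edgeOf y = S.edgeOf x ↔
    y = x ∨ y = S.flipVertex x ∨ y = S.flipFace x ∨ y = S.flipVertex (S.flipFace x) := by
  constructor
  · intro h
    have h' : Relation.EqvGen (fun a b => b = S.flipVertex a ∨ b = S.flipFace a) x y :=
      Quotient.exact h.symm
    let Q : Φ → Prop := fun y =>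
      y = x ∨ y = S.flipVertex x ∨ y = S.flipFace x ∨ y = S.flipVertex (S.flipFace x)
    have hV : ∀ a, Q a → Q (S.flipVertex a) := by
      rintro a (rfl | rfl | rfl | rfl) <;> simp [Q, S.flipVertex_flipVertex]
    have hF : ∀ a, Q a → Q (S.flipFace a) := by
      rintro a (rfl | rfl | rfl | rfl) <;>
        simp [Q, S.flipFace_flipFace, S.flip_comm]
    have hQ : Q x ↔ Q y := h'.iff_of_step <| by
      rintro a b (rfl | rfl)
      · exact ⟨hV a, fun hb => by simpa only [S.flipVertex_flipVertex] using hV _ hb⟩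
      · exact ⟨hF a, fun hb => by simpa only [S.flipFace_flipFace] using hF _ hb⟩
    exact hQ.1 (Or.inl rfl)
  · rintro (rfl | rfl | rfl | rfl) <;> simp

theorem card_flags_of_edge [Fintype Φ] [DecidableEq S.Edge] (x : Φ) :
    (Finset.univ.filter fun y => S.edgeOf y = S.edgeOf x).card = 4 := by
  classical
  have h1 := S.flipVertex_ne x
  have h2 := S.flipFace_ne x
  have h3 := S.flipVertex_ne_flipFace x
  have h4 : S.flipVertex (S.flipFace x) ≠ S.flipFace x := S.flipVertex_ne _
  have h5 : S.flipVertex (S.flipFace x) ≠ S.flipVertex x := fun h => h2 <| by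
    simpa only [S.flipVertex_flipVertex] using congrArg S.flipVertex h
  have h6 : S.flipVertex (S.flipFace x) ≠ x := fun h => h3.symm <| by
    simpa only [S.flipVertex_flipVertex] using congrArg S.flipVertex h
  have : (Finset.univ.filter fun y => S.edgeOf y = S.edgeOf x) =
      {x, S.flipVertex x, S.flipFace x, S.flipVertex (S.flipFace x)} := by
    ext y
    simp [S.edgeOf_eq_iff]
  rw [this, Finset.card_insert_of_notMem, Finset.card_insert_of_notMem, Finset.card_insert_of_notMem,
    Finset.card_singleton]
  · simpa using h4.symm
  · simpa using ⟨h3, h5.symm⟩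
  · simpa using ⟨h1.symm, h2.symm, h6.symm⟩

/-- Two flags lie in the same component of the complement of the edge set `A`. -/
def regionSetoid (A : Set S.Edge) : Setoid Φ :=
  Relation.EqvGen.setoid fun x y =>
    y = S.flipVertex x ∨ y = S.flipEdge x ∨ (y = S.flipFace x ∧ S.edgeOf x ∉ A)

/-- Two flags lie in the same corner, at the same vertex, between edges of `A`. -/
def cornerSetoid (A : Set S.Edge) : Setoid Φ :=
  Relation.EqvGen.setoid fun x y => y = S.flipEdge x ∨ (y = S.flipFace x ∧ S.edgeOf x ∉ A)

/-- The number of components of the complement of the edge set `A`. -/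
noncomputable def regionCount (A : Set S.Edge) : ℕ := Nat.card (Quotient (S.regionSetoid A))

variable {S} in
theorem regionSetoid_of_cornerSetoid {A : Set S.Edge} {x y : Φ} (h : S.cornerSetoid A x y) :
    S.regionSetoid A x y :=
  Relation.EqvGen.mono_of_step (s := S.regionSetoid A)
    (fun _ _ hab => Relation.EqvGen.rel _ _ (Or.inr hab)) h

variable {S} in
theorem vertexOf_eq_of_cornerSetoid {A : Set S.Edge} {x y : Φ} (h : S.cornerSetoid A x y) :
    S.vertexOf x = S.vertexOf y :=
  Quotient.sound <| Relation.EqvGen.mono_of_step (s := S.vertexSetoid)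
    (fun _ _ hab => Relation.EqvGen.rel _ _ (hab.imp_right And.left)) h

theorem cornerSetoid_flipEdge (A : Set S.Edge) (x : Φ) :
    S.cornerSetoid A x (S.flipEdge x) := .rel _ _ (Or.inl rfl)

theorem cornerSetoid_flipFace {A : Set S.Edge} {x : Φ} (hx : S.edgeOf x ∉ A) :
    S.cornerSetoid A x (S.flipFace x) := .rel _ _ (Or.inr ⟨rfl, hx⟩)

theorem regionSetoid_flipVertex (A : Set S.Edge) (x : Φ) :
    S.regionSetoid A x (S.flipVertex x) := .rel _ _ (Or.inl rfl)

theorem regionSetoid_flipEdge (A : Set S.Edge) (x : Φ) :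
    S.regionSetoid A x (S.flipEdge x) := .rel _ _ (Or.inr (Or.inl rfl))

theorem regionSetoid_flipFace {A : Set S.Edge} {x : Φ} (hx : S.edgeOf x ∉ A) :
    S.regionSetoid A x (S.flipFace x) := .rel _ _ (Or.inr (Or.inr ⟨rfl, hx⟩))

variable {S} in
/-- A set of flags closed under all flips is everything. -/
theorem mem_of_closed {T : Set Φ} (hV : ∀ x ∈ T, S.flipVertex x ∈ T)
    (hE : ∀ x ∈ T, S.flipEdge x ∈ T) (hF : ∀ x ∈ T, S.flipFace x ∈ T)
    {x : Φ} (hx : x ∈ T) (y : Φ) : y ∈ T := by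
  refine ((S.connected x y).iff_of_step (Q := (· ∈ T)) ?_).1 hx
  rintro a b (rfl | rfl | rfl)
  · exact ⟨hV a, fun h => by simpa only [S.flipVertex_flipVertex] using hV _ h⟩
  · exact ⟨hE a, fun h => by simpa only [S.flipEdge_flipEdge] using hE _ h⟩
  · exact ⟨hF a, fun h => by simpa only [S.flipFace_flipFace] using hF _ h⟩

variable {S} in
/-- A set of flags closed under the flips that fix a vertex contains all flags at that vertex. -/
theorem mem_of_vertexOf_eq {T : Set Φ}
    (hE : ∀ x ∈ T, S.flipEdge x ∈ T) (hF : ∀ x ∈ T, S.flipFace x ∈ T)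
    {x y : Φ} (hx : x ∈ T) (hxy : S.vertexOf x = S.vertexOf y) : y ∈ T := by
  have h : Relation.EqvGen (fun x y => y = S.flipEdge x ∨ y = S.flipFace x) x y :=
    Quotient.exact hxy
  refine (h.iff_of_step (Q := (· ∈ T)) ?_).1 hx
  rintro a b (rfl | rfl)
  · exact ⟨hE a, fun h => by simpa only [S.flipEdge_flipEdge] using hE _ h⟩
  · exact ⟨hF a, fun h => by simpa only [S.flipFace_flipFace] using hF _ h⟩

open scoped Classical in
variable {S} in
/-- A union of corners is bounded by an even number of flags. -/
theorem even_card_boundary_flags [Fintype Φ] (A : Set S.Edge) (T : Set Φ)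
    (hE : ∀ x ∈ T, S.flipEdge x ∈ T) (hF : ∀ x ∈ T, S.edgeOf x ∉ A → S.flipFace x ∈ T) :
    Even (Finset.univ.filter fun x => x ∈ T ∧ S.edgeOf x ∈ A).card := by
  -- `flipEdge` pairs off all flags of `T`, and `flipFace` pairs off those not on `A`. The flags on
  -- `A` are the difference.
  have h1 : Even (Finset.univ.filter fun x => x ∈ T).card :=
    Finset.even_card_of_involution _ S.flipEdge (fun x hx => by simp at hx ⊢; exact hE x hx)
      (fun x _ => S.flipEdge_ne x) (fun x _ => S.flipEdge_flipEdge x)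
  have h2 : Even (Finset.univ.filter fun x => x ∈ T ∧ ¬ S.edgeOf x ∈ A).card :=
    Finset.even_card_of_involution _ S.flipFace
      (fun x hx => by simp at hx ⊢; exact ⟨hF x hx.1 hx.2, hx.2⟩)
      (fun x _ => S.flipFace_ne x) (fun x _ => S.flipFace_flipFace x)
  have h3 := Finset.card_filter_add_card_filter_not
    (s := Finset.univ.filter fun x => x ∈ T) (fun x => S.edgeOf x ∈ A)
  rw [Finset.filter_filter, Finset.filter_filter] at h3
  rw [← h3] at h1
  exact (Nat.even_add.1 h1).2 h2

variable {S} in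
/-- A corner that is bounded by an edge has a second bounding flag. -/
theorem exists_ne_cornerSetoid [Finite Φ] {A : Set S.Edge} {x : Φ} (hx : S.edgeOf x ∈ A) :
    ∃ y, y ≠ x ∧ S.edgeOf y ∈ A ∧ S.cornerSetoid A x y := by
  classical
  have := Fintype.ofFinite Φ
  have h := even_card_boundary_flags A {y | S.cornerSetoid A x y}
    (fun y hy => (S.cornerSetoid A).trans hy (S.cornerSetoid_flipEdge A y))
    (fun y hy hyA => (S.cornerSetoid A).trans hy (S.cornerSetoid_flipFace hyA))
  by_contra! hcon
  have h1 : (Finset.univ.filter fun y => y ∈ {y | S.cornerSetoid A x y} ∧ S.edgeOf y ∈ A) = {x} := by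
    ext y
    simp only [Set.mem_ofPred_eq, Finset.mem_filter, Finset.mem_univ, true_and,
      Finset.mem_singleton]
    constructor
    · rintro ⟨h1, h2⟩
      by_contra hne
      exact hcon y hne h2 h1
    · rintro rfl
      exact ⟨(S.cornerSetoid A).refl _, hx⟩
  rw [h1, Finset.card_singleton] at h
  exact absurd h (by decide)

/-! ### Counting regions, and Euler's inequality -/

theorem regionSetoid_mono {A B : Set S.Edge} (h : A ⊆ B) : S.regionSetoid B ≤ S.regionSetoid A := by
  intro x y hxy
  refine Relation.EqvGen.mono_of_step (s := S.regionSetoid A) ?_ hxy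
  rintro a b (rfl | rfl | ⟨rfl, hb⟩)
  · exact S.regionSetoid_flipVertex A a
  · exact S.regionSetoid_flipEdge A a
  · exact S.regionSetoid_flipFace fun ha => hb (h ha)

variable {S} in
/-- Removing from an edge set an edge both of whose sides are already identified by `s`. -/
theorem regionSetoid_le_of_flipFace {A : Set S.Edge} {x : Φ} {s : Setoid Φ}
    (hs : S.regionSetoid (insert (S.edgeOf x) A) ≤ s) (hx : s x (S.flipFace x)) :
    S.regionSetoid A ≤ s := by
  intro y z hyz
  refine Relation.EqvGen.mono_of_step ?_ hyz
  have hV : ∀ a, s a (S.flipVertex a) := fun a => hs (S.regionSetoid_flipVertex _ a)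
  rintro a b (rfl | rfl | ⟨rfl, hb⟩)
  · exact hV a
  · exact hs (S.regionSetoid_flipEdge _ a)
  · by_cases ha : S.edgeOf a = S.edgeOf x
    · have h' : s (S.flipVertex x) (S.flipVertex (S.flipFace x)) :=
        s.trans (s.symm (hV x)) (s.trans hx (hV _))
      rcases (S.edgeOf_eq_iff x a).1 ha with rfl | rfl | rfl | rfl
      · exact hx
      · rwa [← S.flip_comm]
      · rw [S.flipFace_flipFace]
        exact s.symm hx
      · rw [← S.flip_comm, S.flipFace_flipFace]
        exact s.symm h'
    · exact hs (S.regionSetoid_flipFace fun h => h.elim ha hb)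

/-- Erasing an edge only joins the regions on its two sides, so at most one region is lost. -/
theorem regionCount_insert_le [Finite Φ] (A : Set S.Edge) (a : S.Edge) :
    S.regionCount (insert a A) ≤ S.regionCount A + 1 := by
  obtain ⟨x, rfl⟩ : ∃ x, S.edgeOf x = a := Quotient.exists_rep a
  exact Setoid.card_quotient_le_add_one _ _ x (S.flipFace x)
    fun s hs hx => regionSetoid_le_of_flipFace hs hx

theorem regionCount_univ : S.regionCount Set.univ = Nat.card S.Polygon := by
  have : S.regionSetoid Set.univ = S.polygonSetoid := by
    simp [regionSetoid, polygonSetoid]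
  rw [regionCount, this]
  rfl

/-- The polygons are the regions cut out by all edges; erasing the edges of `B` one by one loses at
most one region each time. -/
theorem card_polygon_le [Finite Φ] (B : Finset S.Edge) :
    Nat.card S.Polygon ≤ S.regionCount (↑B)ᶜ + B.card := by
  classical
  induction B using Finset.induction_on with
  | empty => simp [regionCount_univ]
  | insert a B ha ih =>
    rw [Finset.card_insert_of_notMem ha]
    have h := S.regionCount_insert_le (↑(insert a B))ᶜ a
    have h' : insert a ((↑(insert a B) : Set S.Edge)ᶜ) = (↑B)ᶜ := by
      ext b
      by_cases hb : b = a
      · simp [hb, ha]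
      · simp [hb]
    rw [h'] at h
    omega

instance [Finite Φ] : Finite S.Edge := inferInstanceAs (Finite (Quotient S.edgeSetoid))
instance [Finite Φ] : Finite S.Vertex := inferInstanceAs (Finite (Quotient S.vertexSetoid))

variable {S} in
/-- Adding a pendant edge does not separate the complement. -/
theorem regionSetoid_insert_pendant [Finite Φ] {A : Set S.Edge} {W : Set S.Vertex}
    (hA : ∀ x, S.edgeOf x ∈ A → S.vertexOf x ∈ W) {y : Φ} (hy : S.vertexOf y ∉ W)
    (hy' : S.vertexOf (S.flipVertex y) ∈ W) :
    S.regionSetoid (insert (S.edgeOf y) A) = S.regionSetoid A := by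
  refine le_antisymm (S.regionSetoid_mono (Set.subset_insert _ _))
    (regionSetoid_le_of_flipFace le_rfl ?_)
  obtain ⟨z, hz, hzA, hzy⟩ :=
    exists_ne_cornerSetoid (A := insert (S.edgeOf y) A) (Set.mem_insert (S.edgeOf y) A)
  have hv := vertexOf_eq_of_cornerSetoid hzy
  have hz1 : S.edgeOf z = S.edgeOf y :=
    hzA.resolve_right fun h => hy (hv ▸ hA z h)
  rcases (S.edgeOf_eq_iff y z).1 hz1 with rfl | rfl | rfl | rfl
  · exact absurd rfl hz
  · exact absurd (hv ▸ hy') hy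
  · exact regionSetoid_of_cornerSetoid hzy
  · rw [vertexOf_flipVertex_flipFace] at hv
    exact absurd (hv ▸ hy') hy

variable {S} in
-- Connectedness of the surface passes to its 1-skeleton, because only `flipVertex` changes the
-- vertex of a flag.
theorem exists_edge_leaving {W : Set S.Vertex} (hW : W.Nonempty) (hW' : W ≠ Set.univ) :
    ∃ y, S.vertexOf y ∉ W ∧ S.vertexOf (S.flipVertex y) ∈ W := by
  by_contra! hcon
  obtain ⟨w, hw⟩ := hW
  obtain ⟨x, rfl⟩ : ∃ x, S.vertexOf x = w := Quotient.exists_rep w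
  refine hW' (Set.eq_univ_of_forall fun u => ?_)
  obtain ⟨z, rfl⟩ : ∃ z, S.vertexOf z = u := Quotient.exists_rep u
  refine mem_of_closed (S := S) (T := {x | S.vertexOf x ∈ W}) ?_ ?_ ?_ hw z
  · intro a ha
    by_contra h
    exact hcon _ h (by rwa [S.flipVertex_flipVertex])
  · intro a ha; simpa using ha
  · intro a ha; simpa using ha

/-- Euler's inequality for a graph on a surface, with vertex set `W` and edge set `A`. -/
theorem eulerChar_le [Finite Φ] (W : Finset S.Vertex) (A : Finset S.Edge) (hW : W.Nonempty)
    (hA : ∀ x, S.edgeOf x ∈ A → S.vertexOf x ∈ W) :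
    S.eulerChar ≤ W.card - A.card + S.regionCount A := by
  classical
  have := Fintype.ofFinite S.Edge
  have := Fintype.ofFinite S.Vertex
  induction hk : (Wᶜ).card generalizing W A with
  | zero =>
    -- Here `W` contains every vertex, and each edge outside `A` accounts for at most one further
    -- polygon.
    have h := S.card_polygon_le Aᶜ
    rw [Finset.coe_compl, compl_compl] at h
    have h1 := Finset.card_add_card_compl A
    have h2 := Finset.card_add_card_compl W
    rw [eulerChar, Nat.card_eq_fintype_card (α := S.Vertex), Nat.card_eq_fintype_card (α := S.Edge)]
    omega
  | succ k ih =>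
    have hne : (W : Set S.Vertex) ≠ Set.univ := by
      intro h
      rw [Finset.coe_eq_univ] at h
      simp [h] at hk
    obtain ⟨y, hy, hy'⟩ := exists_edge_leaving (W := (W : Set S.Vertex)) (by simpa using hW) hne
    -- Growing the graph by a pendant edge adds one vertex and one edge and no region, so the
    -- right-hand side is unchanged.
    have hreg := regionSetoid_insert_pendant (A := (A : Set S.Edge)) (W := (W : Set S.Vertex))
      (by simpa using hA) hy hy'
    have hyA : S.edgeOf y ∉ A := fun h => hy (hA y h)
    have := ih (insert (S.vertexOf y) W) (insert (S.edgeOf y) A) (Finset.insert_nonempty _ _)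
      (by
        intro x hx
        rw [Finset.mem_insert] at hx ⊢
        rcases hx with hx | hx
        · rcases (S.edgeOf_eq_iff y x).1 hx with rfl | rfl | rfl | rfl
          · simp
          · exact Or.inr hy'
          · simp
          · rw [vertexOf_flipVertex_flipFace]
            exact Or.inr hy'
        · exact Or.inr (hA x hx))
      (by
        rw [Finset.compl_insert, Finset.card_erase_of_mem (by simpa using hy), hk]
        rfl)
    rw [Finset.card_insert_of_notMem hyA, Finset.card_insert_of_notMem (by simpa using hy),
      Finset.coe_insert, regionCount, hreg] at this
    rw [regionCount]
    push_cast at this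
    linarith

end CellSurface

/-! ### Faces of an embedded graph and their boundaries -/

namespace SurfaceEmbedding

variable {V Φ : Type*} {G : SimpleGraph V} {S : CellSurface Φ} (E : SurfaceEmbedding G S)

theorem exists_adj_of_mem_range {x : Φ} (hx : S.edgeOf x ∈ Set.range E.edge) :
    ∃ u v, G.Adj u v ∧ S.vertexOf x = E.vert u ∧ S.vertexOf (S.flipVertex x) = E.vert v := by
  obtain ⟨⟨e, he⟩, hex⟩ := hx
  have h := E.ends ⟨e, he⟩ x hex.symm
  induction e using Sym2.ind with
  | _ u v =>
    rw [Sym2.map_mk, Sym2.eq_iff] at h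
    rcases h with ⟨h1, h2⟩ | ⟨h1, h2⟩
    · exact ⟨u, v, he, h1, h2⟩
    · exact ⟨v, u, SimpleGraph.Adj.symm he, h1, h2⟩

theorem exists_flag_of_adj {u v : V} (h : G.Adj u v) :
    ∃ x, S.edgeOf x ∈ Set.range E.edge ∧ S.vertexOf x = E.vert u ∧
      S.vertexOf (S.flipVertex x) = E.vert v := by
  obtain ⟨x, hx⟩ : ∃ x, S.edgeOf x = E.edge ⟨s(u, v), h⟩ := Quotient.exists_rep _
  have h' := E.ends _ x hx
  rw [Sym2.map_mk, Sym2.eq_iff] at h'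
  rcases h' with ⟨h1, h2⟩ | ⟨h1, h2⟩
  · exact ⟨x, ⟨_, hx.symm⟩, h1, h2⟩
  · refine ⟨S.flipVertex x, ⟨⟨s(u, v), h⟩, ?_⟩, h2, ?_⟩
    · exact hx.symm.trans (S.edgeOf_flipVertex x).symm
    · rwa [S.flipVertex_flipVertex]

variable {E}

theorem vertexOf_flipVertex_ne {x : Φ} (hx : S.edgeOf x ∈ Set.range E.edge) :
    S.vertexOf (S.flipVertex x) ≠ S.vertexOf x := by
  obtain ⟨u, v, huv, h1, h2⟩ := E.exists_adj_of_mem_range hx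
  rw [h1, h2]
  exact fun h => huv.ne (E.vert.injective h).symm

theorem edgeOf_eq_of_ends_eq {x y : Φ} (hx : S.edgeOf x ∈ Set.range E.edge)
    (hy : S.edgeOf y ∈ Set.range E.edge) (h1 : S.vertexOf x = S.vertexOf y)
    (h2 : S.vertexOf (S.flipVertex x) = S.vertexOf (S.flipVertex y)) :
    S.edgeOf x = S.edgeOf y := by
  obtain ⟨e, he⟩ := hx
  obtain ⟨e', he'⟩ := hy
  have h3 := E.ends e x he.symm
  have h4 := E.ends e' y he'.symm
  rw [h1, h2, h4] at h3
  rw [← he, ← he', Subtype.ext (Sym2.map.injective E.vert.injective h3)]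

theorem faceOf_eq_of_cornerSetoid {x y : Φ} (h : S.cornerSetoid (Set.range E.edge) x y) :
    E.faceOf x = E.faceOf y :=
  Quotient.sound (CellSurface.regionSetoid_of_cornerSetoid h)

@[simp] theorem faceOf_flipVertex (x : Φ) : E.faceOf (S.flipVertex x) = E.faceOf x :=
  (Quotient.sound (S.regionSetoid_flipVertex (Set.range E.edge) x) :
    E.faceOf x = E.faceOf (S.flipVertex x)).symm

@[simp] theorem faceOf_flipEdge (x : Φ) : E.faceOf (S.flipEdge x) = E.faceOf x :=
  (Quotient.sound (S.regionSetoid_flipEdge (Set.range E.edge) x) :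
    E.faceOf x = E.faceOf (S.flipEdge x)).symm

theorem faceOf_flipFace {x : Φ} (hx : S.edgeOf x ∉ Set.range E.edge) :
    E.faceOf (S.flipFace x) = E.faceOf x :=
  (Quotient.sound (S.regionSetoid_flipFace hx) : E.faceOf x = E.faceOf (S.flipFace x)).symm

section Counting

open scoped Classical

variable [Fintype Φ]

/-- The flags along the boundary of a face; there are two of them for every side of the face. -/
noncomputable def boundary (F : E.Face) : Finset Φ :=
  Finset.univ.filter fun x => E.faceOf x = F ∧ S.edgeOf x ∈ Set.range E.edge

theorem mem_boundary {F : E.Face} {x : Φ} :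
    x ∈ boundary F ↔ E.faceOf x = F ∧ S.edgeOf x ∈ Set.range E.edge := by
  simp [boundary]

theorem flipVertex_mem_boundary {F : E.Face} {x : Φ} (hx : x ∈ boundary F) :
    S.flipVertex x ∈ boundary F := by
  rw [mem_boundary] at hx ⊢
  simpa using hx

theorem exists_ne_mem_boundary {F : E.Face} {x : Φ} (hx : x ∈ boundary F) :
    ∃ y ∈ boundary F, y ≠ x ∧ S.vertexOf y = S.vertexOf x ∧
      S.cornerSetoid (Set.range E.edge) x y := by
  rw [mem_boundary] at hx
  obtain ⟨y, hy, hyA, hxy⟩ := CellSurface.exists_ne_cornerSetoid hx.2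
  exact ⟨y, mem_boundary.2 ⟨(faceOf_eq_of_cornerSetoid hxy).symm.trans hx.1, hyA⟩, hy,
    (CellSurface.vertexOf_eq_of_cornerSetoid hxy).symm, hxy⟩

/-- A face that has itself on the other side of each of its sides is closed under all flips, hence
is everything by connectedness. -/
theorem mem_face_of_flipFace_mem {F : E.Face}
    (h : ∀ x ∈ boundary F, S.flipFace x ∈ boundary F) (x : Φ) : E.faceOf x = F := by
  obtain ⟨x₀, hx₀⟩ : ∃ x₀, E.faceOf x₀ = F := Quotient.exists_rep F
  refine CellSurface.mem_of_closed (S := S) (T := {x | E.faceOf x = F}) ?_ ?_ ?_ hx₀ x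
  · intro y hy
    simpa using hy
  · intro y hy
    simpa using hy
  · intro y hy
    by_cases hyA : S.edgeOf y ∈ Set.range E.edge
    · exact (mem_boundary.1 (h y (mem_boundary.2 ⟨hy, hyA⟩))).1
    · exact (faceOf_flipFace hyA).trans hy

theorem boundary_nonempty [Nonempty G.edgeSet] (F : E.Face) : (boundary F).Nonempty := by
  by_contra hcon
  rw [Finset.not_nonempty_iff_eq_empty] at hcon
  obtain ⟨e⟩ := ‹Nonempty G.edgeSet›
  obtain ⟨x, hx⟩ : ∃ x, S.edgeOf x = E.edge e := Quotient.exists_rep _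
  have hxF := mem_face_of_flipFace_mem (F := F) (by simp [hcon]) x
  have : x ∈ boundary F := mem_boundary.2 ⟨hxF, ⟨e, hx.symm⟩⟩
  simp [hcon] at this

/-- Three sides of a face give six flags on its boundary. -/
theorem six_flags {F : E.Face} {x y z : Φ} (hx : x ∈ boundary F) (hy : y ∈ boundary F)
    (hz : z ∈ boundary F) (hxy : y ≠ x) (hxy' : y ≠ S.flipVertex x)
    (hzx : z ≠ x) (hzx' : z ≠ S.flipVertex x) (hzy : z ≠ y) (hzy' : z ≠ S.flipVertex y) :
    ({x, S.flipVertex x, y, S.flipVertex y, z, S.flipVertex z} : Finset Φ) ⊆ boundary F ∧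
    ({x, S.flipVertex x, y, S.flipVertex y, z, S.flipVertex z} : Finset Φ).card = 6 := by
  have key : ∀ {a b : Φ}, b ≠ S.flipVertex a → S.flipVertex b ≠ a := by
    intro a b h h'
    exact h (by rw [← h', S.flipVertex_flipVertex])
  have key' : ∀ {a b : Φ}, b ≠ a → S.flipVertex b ≠ S.flipVertex a := by
    intro a b h h'
    exact h (by rw [← S.flipVertex_flipVertex b, h', S.flipVertex_flipVertex])
  constructor
  · intro t ht
    simp only [Finset.mem_insert, Finset.mem_singleton] at ht
    rcases ht with rfl | rfl | rfl | rfl | rfl | rfl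
    exacts [hx, flipVertex_mem_boundary hx, hy, flipVertex_mem_boundary hy, hz,
      flipVertex_mem_boundary hz]
  · have hx' := S.flipVertex_ne x
    have hy' := S.flipVertex_ne y
    have hz' := S.flipVertex_ne z
    rw [Finset.card_insert_of_notMem, Finset.card_insert_of_notMem, Finset.card_insert_of_notMem,
      Finset.card_insert_of_notMem, Finset.card_insert_of_notMem, Finset.card_singleton]
    · simpa using hz'.symm
    · simpa using ⟨hzy'.symm, (key' hzy).symm⟩
    · simpa using ⟨hy'.symm, hzy.symm, (key hzy').symm⟩
    · simpa using ⟨hxy'.symm, (key' hxy).symm, hzx'.symm, (key' hzx).symm⟩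
    · simpa using ⟨hx'.symm, hxy.symm, (key hxy').symm, hzx.symm, (key hzx').symm⟩

/-- In a graph with at least two edges every face has at least three sides. -/
theorem six_le_card_boundary [Nontrivial G.edgeSet] (F : E.Face) : 6 ≤ (boundary F).card := by
  obtain ⟨x, hx⟩ := boundary_nonempty F
  obtain ⟨y, hy, hyx, hyv, -⟩ := exists_ne_mem_boundary hx
  obtain ⟨z, hz, hzx, hzv, -⟩ := exists_ne_mem_boundary (flipVertex_mem_boundary hx)
  have hxl := vertexOf_flipVertex_ne (mem_boundary.1 hx).2
  have hyx' : y ≠ S.flipVertex x := by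
    rintro rfl
    exact hxl hyv
  suffices h : ∃ t ∈ boundary F, t ≠ x ∧ t ≠ S.flipVertex x ∧ t ≠ y ∧ t ≠ S.flipVertex y by
    obtain ⟨t, ht, h1, h2, h3, h4⟩ := h
    obtain ⟨h5, h6⟩ := six_flags hx hy ht hyx hyx' h1 h2 h3 h4
    rw [← h6]
    exact Finset.card_le_card h5
  -- If the boundary closes up after two sides, these are the two sides of a single edge. If `F` had
  -- no further side, it would be the only face and that edge the only edge.
  by_cases hzy : z = S.flipVertex y
  · subst hzy
    have hedge : S.edgeOf y = S.edgeOf x :=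
      edgeOf_eq_of_ends_eq (mem_boundary.1 hy).2 (mem_boundary.1 hx).2 hyv hzv
    have hyf : y = S.flipFace x := by
      rcases (S.edgeOf_eq_iff x y).1 hedge with h | h | h | h
      · exact absurd h hyx
      · exact absurd h hyx'
      · exact h
      · rw [h, S.vertexOf_flipVertex_flipFace] at hyv
        exact absurd hyv hxl
    subst hyf
    by_contra! hcon
    have hall : ∀ t ∈ boundary F, S.edgeOf t = S.edgeOf x := by
      intro t ht
      rw [S.edgeOf_eq_iff]
      by_contra! h
      exact h.2.2.2 (hcon t ht h.1 h.2.1 h.2.2.1)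
    have hF : ∀ t, E.faceOf t = F := by
      refine mem_face_of_flipFace_mem fun t ht => ?_
      rcases (S.edgeOf_eq_iff x t).1 (hall t ht) with rfl | rfl | rfl | rfl
      · exact hy
      · rw [← S.flip_comm]
        exact flipVertex_mem_boundary hy
      · rwa [S.flipFace_flipFace]
      · rw [← S.flip_comm, S.flipFace_flipFace]
        exact flipVertex_mem_boundary hx
    obtain ⟨e, e', hne⟩ := exists_pair_ne G.edgeSet
    have he : ∀ e, E.edge e = S.edgeOf x := by
      intro e
      obtain ⟨t, ht⟩ : ∃ t, S.edgeOf t = E.edge e := Quotient.exists_rep _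
      rw [← ht]
      exact hall t (mem_boundary.2 ⟨hF t, ⟨e, ht.symm⟩⟩)
    exact hne (E.edge.injective ((he e).trans (he e').symm))
  · refine ⟨z, hz, ?_, hzx, ?_, hzy⟩
    · rintro rfl
      exact hxl hzv.symm
    · rintro rfl
      exact hxl (hzv.symm.trans hyv)

/-- Around a triangular face consecutive neighbours of a vertex coincide or are adjacent. -/
theorem eq_or_adj_of_card_boundary_eq_six {F : E.Face} (hF : (boundary F).card = 6) {x y : Φ}
    (hx : x ∈ boundary F) (hy : y ∈ boundary F) (hxy : S.vertexOf y = S.vertexOf x) {a b : V}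
    (ha : S.vertexOf (S.flipVertex x) = E.vert a) (hb : S.vertexOf (S.flipVertex y) = E.vert b) :
    a = b ∨ G.Adj a b := by
  by_contra! hcon
  obtain ⟨hab, hadj⟩ := hcon
  have hab' : E.vert a ≠ E.vert b := fun h => hab (E.vert.injective h)
  obtain ⟨p, hp, hpx, hpv, -⟩ := exists_ne_mem_boundary (flipVertex_mem_boundary hx)
  obtain ⟨q, hq, hqy, hqv, -⟩ := exists_ne_mem_boundary (flipVertex_mem_boundary hy)
  have hxl := vertexOf_flipVertex_ne (mem_boundary.1 hx).2
  have hyl := vertexOf_flipVertex_ne (mem_boundary.1 hy).2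
  rw [ha] at hpv hxl
  rw [hb] at hqv hyl
  rw [hxy] at hyl
  obtain ⟨h1, h2⟩ := six_flags hx hy hp (by rintro rfl; exact hab' (ha.symm.trans hb))
    (by rintro rfl; exact hxl (ha.symm.trans hxy)) (by rintro rfl; exact hxl hpv.symm) hpx
    (by rintro rfl; exact hxl (hpv.symm.trans hxy))
    (by rintro rfl; exact hab' (hpv.symm.trans hb))
  -- The sides at `x`, `y` and `p` exhaust the face, so the continuation `q` past `b` must be the
  -- far end of the side of `p`, which therefore joins `a` to `b`.
  have h3 := Finset.eq_of_subset_of_card_le h1 (by rw [hF, h2])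
  rw [← h3] at hq
  simp only [Finset.mem_insert, Finset.mem_singleton] at hq
  rcases hq with rfl | rfl | rfl | rfl | rfl | rfl
  · exact hyl hqv.symm
  · exact hab' (ha.symm.trans hqv)
  · exact hyl (hqv.symm.trans hxy)
  · exact hqy rfl
  · exact hab' (hpv.symm.trans hqv)
  · obtain ⟨u, v, huv, h4, h5⟩ := E.exists_adj_of_mem_range (mem_boundary.1 hp).2
    rw [hpv] at h4
    rw [hqv] at h5
    rw [E.vert.injective h4, E.vert.injective h5] at hadj
    exact hadj huv

/-- The flags at `v` along the boundary of a face. -/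
noncomputable def boundaryAt (F : E.Face) (v : V) : Finset Φ :=
  (boundary F).filter fun x => S.vertexOf x = E.vert v

/-- A corner of `F` at `v` not bounded by any edge of `G` would contain all flags at `v`, including
one on the edge `vw`. A bounded corner has two bounding flags. -/
theorem two_le_card_boundaryAt {F : E.Face} {v w : V} (hvw : G.Adj v w) (hv : v ∈ E.faceVerts F) :
    2 ≤ (boundaryAt F v).card := by
  obtain ⟨x, hxF, hxv⟩ := hv
  obtain ⟨y, hyA, hxy⟩ : ∃ y, S.edgeOf y ∈ Set.range E.edge ∧
      S.cornerSetoid (Set.range E.edge) x y := by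
    by_contra! hcon
    obtain ⟨z, hzA, hzv, -⟩ := E.exists_flag_of_adj hvw
    refine hcon z hzA ?_
    refine CellSurface.mem_of_vertexOf_eq (S := S)
      (T := {z | S.cornerSetoid (Set.range E.edge) x z})
      ?_ ?_ ((S.cornerSetoid _).refl x) (hxv.trans hzv.symm)
    · intro t ht
      exact (S.cornerSetoid _).trans ht (S.cornerSetoid_flipEdge _ t)
    · intro t ht
      exact (S.cornerSetoid _).trans ht (S.cornerSetoid_flipFace fun h => hcon t h ht)
  have hyb : y ∈ boundary F :=
    mem_boundary.2 ⟨(faceOf_eq_of_cornerSetoid hxy).symm.trans hxF, hyA⟩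
  have hyv : S.vertexOf y = E.vert v :=
    (CellSurface.vertexOf_eq_of_cornerSetoid hxy).symm.trans hxv
  obtain ⟨z, hzb, hzy, hzv, -⟩ := exists_ne_mem_boundary hyb
  rw [← Finset.card_pair hzy]
  refine Finset.card_le_card fun t ht => ?_
  rw [Finset.mem_insert, Finset.mem_singleton] at ht
  rw [boundaryAt, Finset.mem_filter]
  rcases ht with rfl | rfl
  · exact ⟨hzb, hzv.trans hyv⟩
  · exact ⟨hyb, hyv⟩

theorem exists_mem_faceVerts [Nonempty G.edgeSet] (F : E.Face) : ∃ v, v ∈ E.faceVerts F := by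
  obtain ⟨x, hx⟩ := boundary_nonempty F
  obtain ⟨hxF, hxA⟩ := mem_boundary.1 hx
  obtain ⟨u, -, -, hu, -⟩ := E.exists_adj_of_mem_range hxA
  exact ⟨u, x, hxF, hu⟩

/-! ### The edge bound with an apex, and its equality case -/

variable [Fintype V]

theorem card_boundary (F : E.Face) :
    (boundary F).card = ∑ v ∈ Finset.univ.filter (· ∈ E.faceVerts F), (boundaryAt F v).card := by
  rw [Finset.card_eq_sum_card_fiberwise (f := S.vertexOf)
    (t := (Finset.univ.filter (· ∈ E.faceVerts F)).map E.vert), Finset.sum_map]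
  · rfl
  · intro x hx
    have hx' := mem_boundary.1 hx
    obtain ⟨u, -, -, hu, -⟩ := E.exists_adj_of_mem_range hx'.2
    simp only [Finset.coe_map, Set.mem_image, Finset.coe_filter, Finset.mem_univ, true_and]
    exact ⟨u, ⟨x, hx'.1, hu⟩, hu.symm⟩

noncomputable instance : Fintype E.Face :=
  @Fintype.ofFinite _ (inferInstanceAs (Finite (Quotient E.faceSetoid)))

/-- Double counting: each edge has four flags, and each flag lies in exactly one face. -/
theorem sum_card_boundary : ∑ F : E.Face, (boundary F).card = 4 * G.edgeFinset.card := by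
  have h1 : ∑ F : E.Face, (boundary F).card =
      (Finset.univ.filter fun x : Φ => S.edgeOf x ∈ Set.range E.edge).card := by
    rw [Finset.card_eq_sum_card_fiberwise (f := E.faceOf) (t := Finset.univ) (by simp)]
    refine Finset.sum_congr rfl fun F _ => ?_
    exact congrArg Finset.card (by ext x; simp [mem_boundary, and_comm])
  rw [h1, Finset.card_eq_sum_card_fiberwise (f := S.edgeOf)
    (t := (Finset.univ : Finset G.edgeSet).map E.edge), Finset.sum_map,
    Finset.sum_const_nat (m := 4)]
  · rw [Finset.card_univ, ← SimpleGraph.edgeFinset_card, mul_comm]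
  · intro e _
    obtain ⟨x, hx⟩ : ∃ x, S.edgeOf x = E.edge e := Quotient.exists_rep _
    rw [← S.card_flags_of_edge x, Finset.filter_filter, hx]
    congr 1
    ext y
    simp only [Finset.mem_filter, Finset.mem_univ, true_and, and_iff_right_iff_imp]
    intro h
    exact ⟨e, h.symm⟩
  · intro x hx
    simpa using hx

theorem eulerChar_le_card [Nonempty V] :
    S.eulerChar ≤ Fintype.card V - G.edgeFinset.card + Fintype.card E.Face := by
  have h := S.eulerChar_le ((Finset.univ : Finset V).map E.vert)
    ((Finset.univ : Finset G.edgeSet).map E.edge) (by simp) (by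
      intro x hx
      obtain ⟨u, -, -, hu, -⟩ := E.exists_adj_of_mem_range (x := x) (by simpa using hx)
      simp [hu])
  rw [Finset.card_map, Finset.card_map, Finset.card_univ, Finset.card_univ,
    ← SimpleGraph.edgeFinset_card, Finset.coe_map, Finset.coe_univ, Set.image_univ] at h
  rwa [← Nat.card_eq_fintype_card (α := E.Face)]

/-- The edge bound for a graph on a surface with an apex placed in the face `F`. -/
theorem card_edges_add_card_faceVerts_le [Nonempty V] [Nontrivial G.edgeSet]
    (hdeg : ∀ v, ∃ w, G.Adj v w) (F : E.Face) :
    2 * (G.edgeFinset.card + (Finset.univ.filter (· ∈ E.faceVerts F)).card : ℤ) ≤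
      6 * Fintype.card V - 6 + 6 * S.eulerGenus := by
  have h1 := sum_card_boundary (E := E)
  rw [← Finset.add_sum_erase _ _ (Finset.mem_univ F)] at h1
  have h2 : (Finset.univ.erase F).card * 6 ≤ ∑ F' ∈ Finset.univ.erase F, (boundary F').card :=
    Finset.card_nsmul_le_sum _ _ _ fun F' _ => six_le_card_boundary F'
  have h3 : (Finset.univ.filter (· ∈ E.faceVerts F)).card * 2 ≤ (boundary F).card := by
    rw [card_boundary]
    refine Finset.card_nsmul_le_sum _ (fun v => (boundaryAt F v).card) 2 fun v hv => ?_
    obtain ⟨w, hw⟩ := hdeg v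
    exact two_le_card_boundaryAt hw (by simpa using hv)
  have h4 := Finset.card_erase_add_one (Finset.mem_univ F)
  rw [Finset.card_univ] at h4
  have h5 := eulerChar_le_card (E := E)
  rw [CellSurface.eulerGenus]
  omega

/-- The edge bound combines Euler's inequality with at least six flags for each other face and at
least two flags for each vertex of `F`. Equality in the sum forces equality in every term. -/
theorem card_boundary_of_tight [Nonempty V] [Nontrivial G.edgeSet]
    (hdeg : ∀ v, ∃ w, G.Adj v w) (F : E.Face)
    (htight : 6 * Fintype.card V - 6 + 6 * S.eulerGenus ≤
      2 * (G.edgeFinset.card + (Finset.univ.filter (· ∈ E.faceVerts F)).card : ℤ)) :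
    (∀ F' ≠ F, (boundary F').card = 6) ∧ ∀ v ∈ E.faceVerts F, (boundaryAt F v).card = 2 := by
  have h1 := sum_card_boundary (E := E)
  rw [← Finset.add_sum_erase _ _ (Finset.mem_univ F)] at h1
  have h2' : ∀ F' ∈ Finset.univ.erase F, 6 ≤ (boundary F').card :=
    fun F' _ => six_le_card_boundary F'
  have h3' : ∀ v ∈ Finset.univ.filter (· ∈ E.faceVerts F), 2 ≤ (boundaryAt F v).card := by
    intro v hv
    obtain ⟨w, hw⟩ := hdeg v
    exact two_le_card_boundaryAt hw (by simpa using hv)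
  have h2 := Finset.sum_le_sum (f := fun _ => 6) h2'
  have h3 := Finset.sum_le_sum (f := fun _ => 2) h3'
  have h2i := Finset.sum_eq_sum_iff_of_le (f := fun _ => 6) h2'
  have h3i := Finset.sum_eq_sum_iff_of_le (f := fun _ => 2) h3'
  rw [← card_boundary] at h3 h3i
  rw [Finset.sum_const, smul_eq_mul] at h2 h3 h2i h3i
  have h4 := Finset.card_erase_add_one (Finset.mem_univ F)
  rw [Finset.card_univ] at h4
  have h5 := eulerChar_le_card (E := E)
  rw [CellSurface.eulerGenus] at htight
  constructor
  · intro F' hF'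
    exact ((h2i.1 (by omega)) F' (Finset.mem_erase.2 ⟨hF', Finset.mem_univ _⟩)).symm
  · intro v hv
    exact ((h3i.1 (by omega)) v (by simpa using hv)).symm

/-- If the edge bound is attained, the neighbours of each vertex induce a connected graph. -/
theorem exists_adj_between_neighbors_of_tight [Nonempty V] [Nontrivial G.edgeSet]
    (hdeg : ∀ v, ∃ w, G.Adj v w) (F : E.Face)
    (htight : 6 * Fintype.card V - 6 + 6 * S.eulerGenus ≤
      2 * (G.edgeFinset.card + (Finset.univ.filter (· ∈ E.faceVerts F)).card : ℤ))
    (v : V) (Z : Set V) {a b : V} (hva : G.Adj v a) (ha : a ∈ Z) (hvb : G.Adj v b) (hb : b ∉ Z) :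
    ∃ s ∈ Z, ∃ t ∉ Z, G.Adj v s ∧ G.Adj v t ∧ G.Adj s t := by
  by_contra! hcon
  obtain ⟨htri, htwo⟩ := card_boundary_of_tight hdeg F htight
  let A := Set.range E.edge
  -- `P` marks the edge flags at `v` leading into `Z`. If it spreads across every corner, a walk
  -- around `v` never leaves `Z`.
  let P : Φ → Prop := fun x => S.edgeOf x ∈ A ∧ S.vertexOf x = E.vert v ∧
    ∃ s ∈ Z, S.vertexOf (S.flipVertex x) = E.vert s
  have hPflip : ∀ x, P x → P (S.flipFace x) := by
    rintro x ⟨h1, h2, h3⟩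
    exact ⟨by rwa [S.edgeOf_flipFace], by rwa [S.vertexOf_flipFace],
      by rwa [S.vertexOf_flipVertex_flipFace]⟩
  have hpure₁ : ∀ x y, P x → S.edgeOf y ∈ A → S.cornerSetoid A x y → E.faceOf x ≠ F → P y := by
    rintro x y ⟨hxA, hxv, s, hs, hxs⟩ hyA hxy hxF
    have hyv := (CellSurface.vertexOf_eq_of_cornerSetoid hxy).symm
    obtain ⟨v', t, hvt, hv', ht⟩ := E.exists_adj_of_mem_range hyA
    obtain ⟨v'', s', hvs, hv'', hs'⟩ := E.exists_adj_of_mem_range hxA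
    obtain rfl : v = v' := E.vert.injective (by rw [← hxv, ← hyv, hv'])
    obtain rfl : v = v'' := E.vert.injective (by rw [← hxv, hv''])
    obtain rfl : s = s' := E.vert.injective (by rw [← hxs, hs'])
    refine ⟨hyA, hv', t, ?_, ht⟩
    by_contra htZ
    rcases eq_or_adj_of_card_boundary_eq_six (htri _ hxF) (mem_boundary.2 ⟨rfl, hxA⟩)
      (mem_boundary.2 ⟨(faceOf_eq_of_cornerSetoid hxy).symm, hyA⟩) hyv hxs ht with h | h
    · exact htZ (h ▸ hs)
    · exact hcon s hs t htZ hvs hvt h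
  have hPeven : Even (Finset.univ.filter P).card :=
    Finset.even_card_of_involution _ S.flipFace
      (fun x hx => by simpa using hPflip x (by simpa using hx))
      (fun x _ => S.flipFace_ne x) (fun x _ => S.flipFace_flipFace x)
  -- Corners outside `F` lie in triangles, so both their bounding flags satisfy `P` or neither does.
  -- By parity the number of `P`-flags in `F` is even as well.
  have hP₁ : Even ((Finset.univ.filter P).filter fun x => ¬ E.faceOf x = F).card := by
    have h := CellSurface.even_card_boundary_flags (S := S) A
      {x | E.faceOf x ≠ F ∧ ∃ p, P p ∧ S.cornerSetoid A p x}
      (by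
        rintro x ⟨hx, p, hp, hpx⟩
        exact ⟨by rwa [faceOf_flipEdge], p, hp,
          (S.cornerSetoid A).trans hpx (S.cornerSetoid_flipEdge A x)⟩)
      (by
        rintro x ⟨hx, p, hp, hpx⟩ hxA
        exact ⟨by rwa [faceOf_flipFace hxA], p, hp,
          (S.cornerSetoid A).trans hpx (S.cornerSetoid_flipFace hxA)⟩)
    convert h using 2
    ext x
    simp only [Finset.mem_filter, Finset.mem_univ, true_and, Set.mem_ofPred_eq]
    constructor
    · rintro ⟨hx, hxF⟩
      exact ⟨⟨hxF, x, hx, (S.cornerSetoid A).refl x⟩, hx.1⟩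
    · rintro ⟨⟨hxF, p, hp, hpx⟩, hxA⟩
      exact ⟨hpure₁ p x hp hxA hpx (by rwa [faceOf_eq_of_cornerSetoid hpx]), hxF⟩
  have hP₂ : Even ((Finset.univ.filter P).filter fun x => E.faceOf x = F).card := by
    rw [← Finset.card_filter_add_card_filter_not (s := Finset.univ.filter P)
      (fun x => E.faceOf x = F)] at hPeven
    exact (Nat.even_add.1 hPeven).2 hP₁
  have hpure : ∀ x y, P x → S.edgeOf y ∈ A → S.cornerSetoid A x y → P y := by
    intro x y hx hyA hxy
    by_cases hxF : E.faceOf x = F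
    · have hsub : ((Finset.univ.filter P).filter fun x => E.faceOf x = F) ⊆ boundaryAt F v := by
        intro t ht
        simp only [Finset.mem_filter, Finset.mem_univ, true_and] at ht
        rw [boundaryAt, Finset.mem_filter, mem_boundary]
        exact ⟨⟨ht.2, ht.1.1⟩, ht.1.2.1⟩
      have hpos : 0 < ((Finset.univ.filter P).filter fun x => E.faceOf x = F).card :=
        Finset.card_pos.2 ⟨x, by simpa using ⟨hx, hxF⟩⟩
      have hcard := htwo v ⟨x, hxF, hx.2.1⟩
      -- `F` has only two flags at `v`; an even positive number of them satisfies `P`, hence both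
      -- do.
      have heq := Finset.eq_of_subset_of_card_le hsub (by
        obtain ⟨k, hk⟩ := hP₂
        omega)
      have hy : y ∈ boundaryAt F v := by
        rw [boundaryAt, Finset.mem_filter, mem_boundary]
        exact ⟨⟨(faceOf_eq_of_cornerSetoid hxy).symm.trans hxF, hyA⟩,
          (CellSurface.vertexOf_eq_of_cornerSetoid hxy).symm.trans hx.2.1⟩
      rw [← heq] at hy
      simp only [Finset.mem_filter] at hy
      exact hy.1.2
    · exact hpure₁ x y hx hyA hxy hxF
  obtain ⟨x, hxA, hxv, hxa⟩ := E.exists_flag_of_adj hva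
  obtain ⟨y, hyA, hyv, hyb⟩ := E.exists_flag_of_adj hvb
  have hy : y ∈ {y | ∃ p, P p ∧ S.cornerSetoid A p y} := by
    refine CellSurface.mem_of_vertexOf_eq (S := S) (x := x) ?_ ?_
      ⟨x, ⟨hxA, hxv, a, ha, hxa⟩, (S.cornerSetoid A).refl x⟩ (hxv.trans hyv.symm)
    · rintro t ⟨p, hp, hpt⟩
      exact ⟨p, hp, (S.cornerSetoid A).trans hpt (S.cornerSetoid_flipEdge A t)⟩
    · rintro t ⟨p, hp, hpt⟩
      by_cases htA : S.edgeOf t ∈ A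
      · exact ⟨_, hPflip t (hpure p t hp htA hpt), (S.cornerSetoid A).refl _⟩
      · exact ⟨p, hp, (S.cornerSetoid A).trans hpt (S.cornerSetoid_flipFace htA)⟩
  obtain ⟨p, hp, hpy⟩ := hy
  obtain ⟨-, -, s, hs, hys⟩ := hpure p y hp hyA hpy
  rw [hyb] at hys
  exact hb (E.vert.injective hys ▸ hs)

end Counting

/-- The embedding of an induced subgraph. -/
def induce (E : SurfaceEmbedding G S) (X : Set V) : SurfaceEmbedding (G.induce X) S where
  vert := (Function.Embedding.subtype _).trans E.vert
  edge := (SimpleGraph.Embedding.induce X).mapEdgeSet.trans E.edge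
  ends := by
    rintro ⟨e, he⟩ x hx
    have h := E.ends _ x hx
    rw [h]
    simp [Sym2.map_map]
    rfl

/-- Deleting edges only enlarges the region around the flag `x`. -/
theorem mem_faceVerts_induce (X : Set V) {x : Φ} {v : X} (hv : v.1 ∈ E.faceVerts (E.faceOf x)) :
    v ∈ (E.induce X).faceVerts ((E.induce X).faceOf x) := by
  obtain ⟨y, hy, hyv⟩ := hv
  refine ⟨y, ?_, hyv⟩
  have h : S.regionSetoid (Set.range E.edge) y x := Quotient.exact hy
  refine Quotient.sound (S.regionSetoid_mono ?_ h)
  rintro _ ⟨e, rfl⟩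
  exact ⟨_, rfl⟩

end SurfaceEmbedding

/-! ### List colouring of abstract graphs -/

section ListColoring

open scoped Classical

variable {V C : Type*} {G : SimpleGraph V}

/-- `Y` can be properly coloured from the lists `L`. -/
def ListColorableOn (G : SimpleGraph V) (L : V → Finset C) (Y : Finset V) : Prop :=
  ∃ c : V → C, (∀ v ∈ Y, c v ∈ L v) ∧ ∀ u ∈ Y, ∀ v ∈ Y, G.Adj u v → c u ≠ c v

/-- Every proper nonempty part of `Y` is joined by an edge to the rest of `Y`. -/
def ConnectedOn (G : SimpleGraph V) (Y : Finset V) : Prop :=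
  ∀ Z ⊆ Y, Z.Nonempty → Z ≠ Y → ∃ u ∈ Z, ∃ v ∈ Y \ Z, G.Adj u v

/-- Colour `v` last: its neighbours in `Y` cannot use up its list. -/
theorem ListColorableOn.insert_of_lt {L : V → Finset C} {Y : Finset V} {v : V}
    (h : ListColorableOn G L (Y.erase v)) (hv : (Y.filter (G.Adj v)).card < (L v).card) :
    ListColorableOn G L Y := by
  obtain ⟨c, hc, hadj⟩ := h
  obtain ⟨α, hα, hα'⟩ := Finset.exists_mem_notMem_of_card_lt_card
    ((Finset.card_image_le (f := c)).trans_lt hv)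
  have hα'' : ∀ u ∈ Y, G.Adj v u → c u ≠ α := by
    rintro u hu huv rfl
    exact hα' (Finset.mem_image_of_mem _ (by simpa using ⟨hu, huv⟩))
  refine ⟨Function.update c v α, ?_, ?_⟩
  · intro u hu
    by_cases huv : u = v
    · subst huv; simpa using hα
    · simpa [huv] using hc u (Finset.mem_erase.2 ⟨huv, hu⟩)
  · intro u hu w hw huw
    by_cases huv : u = v
    · subst huv
      have hne := huw.ne'
      simpa [hne] using (hα'' w hw huw).symm
    · by_cases hwv : w = v
      · subst hwv
        simpa [huv] using hα'' u hu huw.symm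
      · simpa [huv, hwv] using hadj u (Finset.mem_erase.2 ⟨huv, hu⟩) w
          (Finset.mem_erase.2 ⟨hwv, hw⟩) huw

/-- Greedy colouring in the reverse of an order that peels off such vertices. The function `c₀` only
supplies a colouring when nothing is left. -/
theorem listColorableOn_of_degenerate {L : V → Finset C} {Y : Finset V}
    (h : ∀ Z ⊆ Y, Z.Nonempty → ∃ v ∈ Z, (Z.filter (G.Adj v)).card < (L v).card)
    (c₀ : V → C) : ListColorableOn G L Y := by
  induction Y using Finset.strongInduction with
  | H Y ih =>
    rcases Y.eq_empty_or_nonempty with rfl | hY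
    · exact ⟨c₀, by simp, by simp⟩
    · obtain ⟨v, hv, hlt⟩ := h Y subset_rfl hY
      exact (ih _ (Finset.erase_ssubset hv) fun Z hZ =>
        h Z (hZ.trans (Finset.erase_subset _ _))).insert_of_lt hlt

/-- A connected graph whose lists are as large as the degrees, and larger at one vertex. -/
theorem ConnectedOn.listColorableOn {L : V → Finset C} {Y : Finset V} (hY : ConnectedOn G Y)
    (hL : ∀ v ∈ Y, (Y.filter (G.Adj v)).card ≤ (L v).card) {z : V} (hz : z ∈ Y)
    (hzL : (Y.filter (G.Adj z)).card < (L z).card) (c₀ : V → C) : ListColorableOn G L Y := by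
  refine listColorableOn_of_degenerate (fun Z hZ hne => ?_) c₀
  by_cases hZY : Z = Y
  · subst hZY
    exact ⟨z, hz, hzL⟩
  · obtain ⟨u, hu, w, hw, huw⟩ := hY Z hZ hne hZY
    rw [Finset.mem_sdiff] at hw
    refine ⟨u, hu, lt_of_lt_of_le (Finset.card_lt_card ?_) (hL u (hZ hu))⟩
    refine ⟨Finset.filter_subset_filter _ hZ, fun hsub => hw.2 ?_⟩
    exact (Finset.mem_filter.1 (hsub (Finset.mem_filter.2 ⟨hw.1, huw⟩))).1

/-- If the neighbours of `a` in `Y` induce a connected graph, then `a` is not a cut vertex. -/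
theorem ConnectedOn.erase {Y : Finset V} (hY : ConnectedOn G Y) {a : V} (ha : a ∈ Y)
    (hnbr : ∀ (Z : Finset V) (s t : V), s ∈ Y → t ∈ Y → G.Adj a s → G.Adj a t → s ∈ Z → t ∉ Z →
      ∃ u ∈ Z, ∃ v ∈ Y, v ∉ Z ∧ G.Adj a u ∧ G.Adj a v ∧ G.Adj u v) :
    ConnectedOn G (Y.erase a) := by
  intro Z hZ hne hneq
  by_contra! hcon
  have hZY : Z ⊆ Y := hZ.trans (Finset.erase_subset _ _)
  have haZ : a ∉ Z := fun h => Finset.notMem_erase a Y (hZ h)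
  have hcon' : ∀ u ∈ Z, ∀ v ∈ Y, v ∉ Z → v ≠ a → ¬ G.Adj u v := fun u hu v hv hvZ hva =>
    hcon u hu v (by simp [hv, hvZ, hva])
  obtain ⟨u, hu, v, hv, huv⟩ := hY Z hZY hne (by rintro rfl; exact haZ ha)
  rw [Finset.mem_sdiff] at hv
  -- Edges leaving `Z` can only end in `a`. Since `insert a Z` also has a leaving edge, necessarily
  -- from `a`, there are neighbours of `a` on both sides, and `hnbr` yields a crossing edge that
  -- avoids `a`.
  obtain rfl : v = a := by
    by_contra hva
    exact hcon' u hu v hv.1 hv.2 hva huv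
  obtain ⟨u', hu', v', hv', huv'⟩ := hY (insert v Z) (Finset.insert_subset ha hZY)
    (Finset.insert_nonempty _ _) (by
      rintro h
      exact hneq (by rw [← h, Finset.erase_insert haZ]))
  rw [Finset.mem_sdiff, Finset.mem_insert, not_or] at hv'
  rcases Finset.mem_insert.1 hu' with rfl | hu'
  · obtain ⟨s, hs, t, ht, htZ, -, hat, hst⟩ :=
      hnbr Z u v' (hZY hu) hv'.1 huv.symm huv' hu hv'.2.2
    exact hcon' s hs t ht htZ hat.ne' hst
  · exact hcon' u' hu' v' hv'.1 hv'.2.2 hv'.2.1 huv'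

theorem ListColorableOn.mono {L : V → Finset C} {Y Y' : Finset V} (h : ListColorableOn G L Y)
    (hY : Y' ⊆ Y) : ListColorableOn G L Y' := by
  obtain ⟨c, hc, hadj⟩ := h
  exact ⟨c, fun v hv => hc v (hY hv), fun u hu v hv => hadj u (hY hu) v (hY hv)⟩

/-- A minimal uncolourable graph is connected. -/
theorem connectedOn_of_critical {L : V → Finset C} {Y : Finset V} (hY : ¬ ListColorableOn G L Y)
    (hcrit : ∀ Z ⊂ Y, ListColorableOn G L Z) : ConnectedOn G Y := by
  intro Z hZ hne hZY
  by_contra! hcon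
  obtain ⟨c, hc, hadj⟩ := hcrit Z (hZ.ssubset_of_ne hZY)
  obtain ⟨c', hc', hadj'⟩ := hcrit (Y \ Z) (Finset.sdiff_ssubset hZ hne)
  refine hY ⟨fun v => if v ∈ Z then c v else c' v, ?_, ?_⟩
  · intro v hv
    dsimp only
    split_ifs with h
    · exact hc v h
    · exact hc' v (Finset.mem_sdiff.2 ⟨hv, h⟩)
  · intro u hu v hv huv
    dsimp only
    split_ifs with h h' h'
    · exact hadj u h v h' huv
    · exact absurd huv (hcon u h v (Finset.mem_sdiff.2 ⟨hv, h'⟩))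
    · exact absurd huv.symm (hcon v h' u (Finset.mem_sdiff.2 ⟨hu, h⟩))
    · exact hadj' u (Finset.mem_sdiff.2 ⟨hu, h⟩) v (Finset.mem_sdiff.2 ⟨hv, h'⟩) huv

/-- In a minimal uncolourable graph no list is larger than the degree. -/
theorem card_le_degree_of_critical {L : V → Finset C} {Y : Finset V}
    (hY : ¬ ListColorableOn G L Y) (hcrit : ∀ Z ⊂ Y, ListColorableOn G L Z) {v : V} (hv : v ∈ Y) :
    (L v).card ≤ (Y.filter (G.Adj v)).card := by
  by_contra! h
  exact hY ((hcrit _ (Finset.erase_ssubset hv)).insert_of_lt h)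

/-- If `Y` is split by `f` into `k` parts of at most two elements, then from lists of `k` colours
one can choose colours that agree only within parts. -/
theorem exists_coloring_of_parts {P : Type*} (f : V → P) (Y : Finset V) (L : V → Finset C)
    (hf : ∀ p, (Y.filter fun v => f v = p).card ≤ 2)
    (hL : ∀ v ∈ Y, (Y.image f).card ≤ (L v).card) (c₀ : V → C) :
    ∃ c : V → C, (∀ v ∈ Y, c v ∈ L v) ∧ ∀ u ∈ Y, ∀ v ∈ Y, c u = c v → f u = f v := by
  induction Y using Finset.strongInduction generalizing L with
  | H Y ih =>
    -- A pair with a common colour `α` is coloured with it. Deleting the part and `α` lowers the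
    -- number of parts and the list sizes by at most one in step. Without such a pair, Hall's
    -- condition holds.
    by_cases hcom : ∃ u ∈ Y, ∃ v ∈ Y, u ≠ v ∧ f u = f v ∧ ¬ Disjoint (L u) (L v)
    · obtain ⟨u, hu, v, hv, huv, hfuv, hd⟩ := hcom
      obtain ⟨α, hαu, hαv⟩ := Finset.not_disjoint_iff.1 hd
      obtain ⟨c, hc, hinj⟩ := ih (Y.filter fun w => f w ≠ f u)
        (Finset.filter_ssubset.2 ⟨u, hu, by simp⟩) (fun w => (L w).erase α)
        (fun p => (Finset.card_le_card
          (Finset.filter_subset_filter _ (Finset.filter_subset _ _))).trans (hf p))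
        (by
          intro w hw
          have h1 : (Y.filter fun w => f w ≠ f u).image f ⊆ (Y.image f).erase (f u) := by
            intro p hp
            obtain ⟨t, ht, rfl⟩ := Finset.mem_image.1 hp
            rw [Finset.mem_filter] at ht
            exact Finset.mem_erase.2 ⟨ht.2, Finset.mem_image_of_mem f ht.1⟩
          have h2 := Finset.card_le_card h1
          rw [Finset.card_erase_of_mem (Finset.mem_image_of_mem f hu)] at h2
          have h3 := hL w (Finset.mem_filter.1 hw).1
          have h4 := Finset.pred_card_le_card_erase (s := L w) (a := α)
          omega)
      have hpart : ∀ w ∈ Y, f w = f u → α ∈ L w := by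
        intro w hw hwu
        have h1 : ({u, v} : Finset V) ⊆ Y.filter fun w => f w = f u := by
          intro t ht
          rw [Finset.mem_insert, Finset.mem_singleton] at ht
          rcases ht with rfl | rfl
          · simpa using hu
          · simpa using ⟨hv, hfuv.symm⟩
        have h2 := Finset.eq_of_subset_of_card_le h1 (by rw [Finset.card_pair huv]; exact hf _)
        have h3 : w ∈ ({u, v} : Finset V) := by
          rw [h2]
          simpa using ⟨hw, hwu⟩
        rw [Finset.mem_insert, Finset.mem_singleton] at h3
        rcases h3 with rfl | rfl
        · exact hαu
        · exact hαv
      have hc' : ∀ w ∈ Y, f w ≠ f u → c w ≠ α ∧ c w ∈ L w := fun w hw hwu =>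
        Finset.mem_erase.1 (hc w (Finset.mem_filter.2 ⟨hw, hwu⟩))
      refine ⟨fun w => if f w = f u then α else c w, ?_, ?_⟩
      · intro w hw
        dsimp only
        split_ifs with h
        · exact hpart w hw h
        · exact (hc' w hw h).2
      · intro w hw t ht
        dsimp only
        split_ifs with h h' h'
        · exact fun _ => h.trans h'.symm
        · exact fun h'' => absurd h''.symm (hc' t ht h').1
        · exact fun h'' => absurd h'' (hc' w hw h).1
        · exact hinj w (Finset.mem_filter.2 ⟨hw, h⟩) t (Finset.mem_filter.2 ⟨ht, h'⟩)
    · push Not at hcom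
      obtain ⟨g, hg, hgL⟩ := (Finset.all_card_le_biUnion_card_iff_exists_injective
        (fun v : Y => L v)).1 (by
          intro s
          -- A set meeting each part at most once is no larger than one list. Otherwise it contains
          -- a pair with disjoint lists, whose union has at least twice as many colours as there are
          -- parts, hence at least `Y.card`.
          by_cases hs : Set.InjOn (fun v : Y => f v) s
          · rcases s.eq_empty_or_nonempty with rfl | ⟨v, hv⟩
            · simp
            · rw [← Finset.card_image_of_injOn hs]
              refine le_trans (Finset.card_le_card ?_) ((hL v v.2).trans
                (Finset.card_le_card (Finset.subset_biUnion_of_mem (fun v : Y => L v) hv)))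
              intro p hp
              obtain ⟨t, -, rfl⟩ := Finset.mem_image.1 hp
              exact Finset.mem_image_of_mem f t.2
          · simp only [Set.InjOn, not_forall] at hs
            obtain ⟨u, hu, v, hv, huv, hne⟩ := hs
            have hd := hcom u u.2 v v.2 (fun h => hne (Subtype.ext h)) huv
            have h1 : s.card ≤ Y.card := by
              rw [← Fintype.card_coe Y]
              exact Finset.card_le_univ s
            have h2 := Finset.card_le_mul_card_image (f := f) Y 2 (fun p _ => hf p)
            have h3 := hL u u.2
            have h4 := hL v v.2
            have h5 := Finset.card_le_card (Finset.union_subset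
              (Finset.subset_biUnion_of_mem (fun v : Y => L v) hu)
              (Finset.subset_biUnion_of_mem (fun v : Y => L v) hv))
            rw [Finset.card_union_of_disjoint hd] at h5
            omega)
      refine ⟨fun v => if h : v ∈ Y then g ⟨v, h⟩ else c₀ v, ?_, ?_⟩
      · intro v hv
        simpa [hv] using hgL ⟨v, hv⟩
      · intro u hu v hv huv
        simp only [hu, hv, dif_pos] at huv
        rw [Subtype.mk.inj (hg huv)]

/-- Passing to an induced subgraph. -/
theorem listColorableOn_induce_iff {L : V → Finset C} (X : Set V) (Y : Finset X) (c₀ : V → C) :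
    ListColorableOn (G.induce X) (fun v => L v) Y ↔
      ListColorableOn G L (Y.map (Function.Embedding.subtype _)) := by
  constructor
  · rintro ⟨c, hc, hadj⟩
    refine ⟨fun v => if h : v ∈ X then c ⟨v, h⟩ else c₀ v, ?_, ?_⟩
    · intro v hv
      obtain ⟨w, hw, rfl⟩ := Finset.mem_map.1 hv
      simpa using hc w hw
    · intro u hu v hv huv
      obtain ⟨u', hu', rfl⟩ := Finset.mem_map.1 hu
      obtain ⟨v', hv', rfl⟩ := Finset.mem_map.1 hv
      simpa using hadj u' hu' v' hv' huv
  · rintro ⟨c, hc, hadj⟩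
    exact ⟨fun v => c v, fun v hv => hc v (Finset.mem_map_of_mem _ hv),
      fun u hu v hv huv => hadj u (Finset.mem_map_of_mem _ hu) v (Finset.mem_map_of_mem _ hv) huv⟩

variable [Fintype V]

/-- A graph on `k + 2` vertices of degree at least `k` without a `K_{k+1}` has choice number at
most `k`: its complement is a matching with at least two edges. -/
theorem listColorableOn_of_card_eq_add_two {L : V → Finset C} {k : ℕ}
    (hn : Fintype.card V = k + 2) (hdeg : ∀ v, k ≤ (Finset.univ.filter (G.Adj v)).card)
    (hL : ∀ v, k ≤ (L v).card) (hK : ¬ ∃ K : Finset V, G.IsNClique (k + 1) K) (c₀ : V → C) :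
    ListColorableOn G L Finset.univ := by
  have hmatch : ∀ {a b c : V}, b ≠ a → c ≠ a → b ≠ c → ¬ G.Adj a b → G.Adj a c := by
    intro a b c hba hca hbc hab
    by_contra hac
    have h1 : Disjoint (Finset.univ.filter (G.Adj a)) {a, b, c} := by
      rw [Finset.disjoint_right]
      intro t ht
      simp only [Finset.mem_insert, Finset.mem_singleton] at ht
      rcases ht with rfl | rfl | rfl <;> simp [*]
    have h2 := Finset.card_le_univ (Finset.univ.filter (G.Adj a) ∪ {a, b, c})
    rw [Finset.card_union_of_disjoint h1, Finset.card_eq_three.2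
      ⟨a, b, c, hba.symm, hca.symm, hbc, rfl⟩, hn] at h2
    have h3 := hdeg a
    omega
  have hnon : ∀ v, ∃ a b, a ≠ v ∧ b ≠ v ∧ a ≠ b ∧ ¬ G.Adj a b := by
    intro v
    by_contra! hcon
    refine hK ⟨Finset.univ.erase v, ?_, ?_⟩
    · intro a ha b hb hab
      exact hcon a b (by simpa using ha) (by simpa using hb) hab
    · rw [Finset.card_erase_of_mem (Finset.mem_univ v), Finset.card_univ, hn]
      rfl
  have : Nonempty V := Fintype.card_pos_iff.1 (by omega)
  obtain ⟨a, b, -, -, hab, hnab⟩ := hnon (Classical.arbitrary V)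
  obtain ⟨c, d, hca, hda, hcd, hncd⟩ := hnon a
  have hcb : c ≠ b := by
    rintro rfl
    exact hnab (hmatch hcd.symm hab hda hncd).symm
  have hdb : d ≠ b := by
    rintro rfl
    exact hnab (hmatch hcd hab hca fun h => hncd h.symm).symm
  -- The parts are the two disjoint non-edges `ab` and `cd` and singletons, so there are at most `k`
  -- of them.
  let f : V → V := fun w => if w = b then a else if w = d then c else w
  obtain ⟨col, hcol, hinj⟩ := exists_coloring_of_parts f Finset.univ L (by
      intro p
      refine (Finset.card_le_card (t := {p, if p = a then b else d}) ?_).trans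
        Finset.card_le_two
      intro w hw
      simp only [Finset.mem_filter, Finset.mem_univ, true_and, f] at hw
      rw [Finset.mem_insert, Finset.mem_singleton]
      split_ifs at hw with h1 h2
      · subst hw
        simp [h1]
      · subst hw
        simp [hca, h2]
      · exact Or.inl hw) (by
      intro v _
      refine le_trans ?_ (hL v)
      have h1 : Finset.univ.image f ⊆ ({b, d} : Finset V)ᶜ := by
        intro p hp
        obtain ⟨w, -, rfl⟩ := Finset.mem_image.1 hp
        simp only [Finset.mem_compl, Finset.mem_insert, Finset.mem_singleton, f]
        split_ifs with h1 h2
        · simpa using ⟨hab, hda.symm⟩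
        · simpa using ⟨hcb, hcd⟩
        · simpa using ⟨h1, h2⟩
      refine (Finset.card_le_card h1).trans ?_
      rw [Finset.card_compl, Finset.card_pair hdb.symm, hn]
      rfl) c₀
  refine ⟨col, hcol, fun u _ v _ huv h => ?_⟩
  have h' := hinj u (Finset.mem_univ u) v (Finset.mem_univ v) h
  have hne := huv.ne
  simp only [f] at h'
  split_ifs at h' with h1 h2 h3 h4 h5 h6 h7
  · exact hne (h1.trans h2.symm)
  · exact hca h'.symm
  · subst h1 h'
    exact hnab huv.symm
  · exact hca h'
  · exact hne (h4.trans h6.symm)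
  · subst h4 h'
    exact hncd huv.symm
  · subst h' h7
    exact hnab huv
  · rename_i h8
    subst h' h8
    exact hncd huv
  · exact hne h'

/-- Colour an independent set `I` with one colour and the connected rest greedily towards `z`. -/
theorem listColorableOn_of_independent {L : V → Finset C} {I : Finset V} {α : C}
    (hI : ∀ u ∈ I, ∀ v ∈ I, ¬ G.Adj u v) (hα : ∀ v ∈ I, α ∈ L v)
    (hconn : ConnectedOn G Iᶜ)
    (hL : ∀ v, (Finset.univ.filter (G.Adj v)).card ≤ (L v).card) {z : V} (hz : z ∉ I)
    (hzL : (Finset.univ.filter (G.Adj z)).card <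
      ((L z).erase α).card + (I.filter (G.Adj z)).card) :
    ListColorableOn G L Finset.univ := by
  have hsplit : ∀ v, (Finset.univ.filter (G.Adj v)).card =
      (I.filter (G.Adj v)).card + ((Iᶜ).filter (G.Adj v)).card := by
    intro v
    rw [← Finset.card_union_of_disjoint (Finset.disjoint_filter_filter disjoint_compl_right),
      ← Finset.filter_union, Finset.union_compl]
  -- A vertex with a neighbour in `I` loses at most one colour and at least one degree, so lists
  -- remain as large as the remaining degrees; `z` keeps a surplus.
  let L' : V → Finset C := fun v => if (I.filter (G.Adj v)).Nonempty then (L v).erase α else L v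
  have hL' : ∀ v, (L v).erase α ⊆ L' v := by
    intro v
    simp only [L']
    split_ifs
    · exact subset_rfl
    · exact Finset.erase_subset _ _
  obtain ⟨c, hc, hadj⟩ := hconn.listColorableOn (L := L') (fun v _ => by
      have h1 := hL v
      rw [hsplit] at h1
      simp only [L']
      split_ifs with h
      · have h2 := Finset.card_pos.2 h
        have h3 := Finset.pred_card_le_card_erase (s := L v) (a := α)
        omega
      · omega) (Finset.mem_compl.2 hz) (by
      have h1 := Finset.card_le_card (hL' z)
      rw [hsplit] at hzL
      omega) (fun _ => α)
  have hcL : ∀ v ∉ I, c v ∈ L v := by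
    intro v hv
    have h := hc v (Finset.mem_compl.2 hv)
    simp only [L'] at h
    split_ifs at h
    · exact Finset.mem_of_mem_erase h
    · exact h
  have hcα : ∀ v ∉ I, ∀ u ∈ I, G.Adj v u → c v ≠ α := by
    intro v hv u hu hvu
    have h := hc v (Finset.mem_compl.2 hv)
    simp only [L'] at h
    rw [if_pos ⟨u, Finset.mem_filter.2 ⟨hu, hvu⟩⟩] at h
    exact Finset.ne_of_mem_erase h
  refine ⟨fun v => if v ∈ I then α else c v, ?_, ?_⟩
  · intro v _
    dsimp only
    split_ifs with hv
    · exact hα v hv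
    · exact hcL v hv
  · intro u _ v _ huv
    dsimp only
    split_ifs with hu hv hv
    · exact absurd huv (hI u hu v hv)
    · exact (hcα v hv u hu huv.symm).symm
    · exact hcα u hu v hv huv
    · exact hadj u (Finset.mem_compl.2 hu) v (Finset.mem_compl.2 hv) huv

/-- Lists as large as the degrees suffice if two nonadjacent neighbours of a vertex can be removed,
one at a time or together, without disconnecting the graph. -/
theorem listColorableOn_of_nonadjacent_pair {L : V → Finset C}
    (hL : ∀ v, (Finset.univ.filter (G.Adj v)).card ≤ (L v).card) {a b z : V} (hab : a ≠ b)
    (hnadj : ¬ G.Adj a b) (hza : G.Adj z a) (hzb : G.Adj z b)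
    (ha : ConnectedOn G ({a} : Finset V)ᶜ) (hb : ConnectedOn G ({b} : Finset V)ᶜ)
    (hab' : ConnectedOn G ({a, b} : Finset V)ᶜ) (hcard : (L z).card < (L a).card + (L b).card) :
    ListColorableOn G L Finset.univ := by
  by_cases hd : Disjoint (L a) (L b)
  -- With disjoint lists, `hcard` prevents `L z` from containing both `L a` and `L b`. Using a
  -- colour outside `L z` on one of them costs `z` nothing.
  · have key : ∀ x, G.Adj z x → ConnectedOn G ({x} : Finset V)ᶜ → ¬ L x ⊆ L z →
        ListColorableOn G L Finset.univ := by
      intro x hzx hx hsub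
      obtain ⟨α, hα, hαz⟩ := Finset.not_subset.1 hsub
      refine listColorableOn_of_independent (I := {x}) (α := α) (by simp) (by simpa using hα) hx hL
        (z := z) (by simpa using hzx.ne) ?_
      rw [Finset.erase_eq_of_notMem hαz, Finset.filter_singleton, if_pos hzx,
        Finset.card_singleton]
      exact Nat.lt_succ_of_le (hL z)
    by_cases haz : L a ⊆ L z
    · refine key b hzb hb fun hbz => ?_
      have h := Finset.card_le_card (Finset.union_subset haz hbz)
      rw [Finset.card_union_of_disjoint hd] at h
      omega
    · exact key a hza ha haz
  · obtain ⟨α, hαa, hαb⟩ := Finset.not_disjoint_iff.1 hd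
    refine listColorableOn_of_independent (I := {a, b}) (α := α) ?_ (by simpa using ⟨hαa, hαb⟩)
      hab' hL (z := z) (by simpa using ⟨hza.ne, hzb.ne⟩) ?_
    · have hnadj' : ¬ G.Adj b a := fun h => hnadj h.symm
      simp [hnadj, hnadj']
    · have h1 : ({a, b} : Finset V).filter (G.Adj z) = {a, b} :=
        Finset.filter_true_of_mem (by simpa using ⟨hza, hzb⟩)
      have h2 := Finset.pred_card_le_card_erase (s := L z) (a := α)
      have h3 := hL z
      have h4 : 0 < (Finset.univ.filter (G.Adj z)).card :=
        Finset.card_pos.2 ⟨a, by simpa using hza⟩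
      rw [h1, Finset.card_pair hab]
      omega

/-- Degree-choosability of a noncomplete connected graph with connected neighbourhoods. -/
theorem ConnectedOn.listColorableOn_of_connected_neighborhoods {L : V → Finset C}
    (hconn : ConnectedOn G Finset.univ)
    (hnbr : ∀ (v : V) (Z : Set V) (a b : V), G.Adj v a → a ∈ Z → G.Adj v b → b ∉ Z →
      ∃ s ∈ Z, ∃ t ∉ Z, G.Adj v s ∧ G.Adj v t ∧ G.Adj s t)
    (hL : ∀ v, (Finset.univ.filter (G.Adj v)).card ≤ (L v).card)
    (hcard : ∀ a b z, (L z).card < (L a).card + (L b).card)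
    (hG : ∃ a b, a ≠ b ∧ ¬ G.Adj a b) : ListColorableOn G L Finset.univ := by
  have hnbr' : ∀ (Y : Finset V) (a : V), (∀ v, G.Adj a v → v ∈ Y) →
      ∀ (Z : Finset V) (s t : V), s ∈ Y → t ∈ Y → G.Adj a s → G.Adj a t → s ∈ Z → t ∉ Z →
      ∃ u ∈ Z, ∃ v ∈ Y, v ∉ Z ∧ G.Adj a u ∧ G.Adj a v ∧ G.Adj u v := by
    intro Y a hY Z s t _ _ has hat hs ht
    obtain ⟨u, hu, v, hv, hau, hav, huv⟩ := hnbr a Z s t has hs hat ht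
    exact ⟨u, hu, v, hY v hav, hv, hau, hav, huv⟩
  have herase : ∀ a, ConnectedOn G ({a} : Finset V)ᶜ := by
    intro a
    have h := hconn.erase (Finset.mem_univ a) (hnbr' _ a fun _ _ => Finset.mem_univ _)
    rwa [← Finset.compl_singleton] at h
  obtain ⟨a, a', haa', hnaa'⟩ := hG
  -- An edge leaving the closed neighbourhood of `a` gives a vertex `b` at distance two from `a`,
  -- with common neighbour `z`.
  obtain ⟨z, hz, b, hb, hzb⟩ := hconn (insert a (Finset.univ.filter (G.Adj a)))
    (Finset.subset_univ _) (Finset.insert_nonempty _ _) (fun h => by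
      have h' : a' ∈ insert a (Finset.univ.filter (G.Adj a)) := 
        (Finset.ext_iff.1 h a').2 (Finset.mem_univ a')
      simp [haa'.symm, hnaa'] at h')
  simp only [Finset.mem_sdiff, Finset.mem_insert, Finset.mem_filter, Finset.mem_univ, true_and,
    not_or] at hz hb
  have haz : G.Adj a z := by
    rcases hz with rfl | hz
    · exact absurd hzb hb.2
    · exact hz
  refine listColorableOn_of_nonadjacent_pair hL (Ne.symm hb.1) hb.2 haz.symm hzb (herase a)
    (herase b) ?_ (hcard a b z)
  -- Since `b` is not a neighbour of `a`, removing it leaves the neighbourhood of `a` intact.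
  have h := (herase b).erase (a := a) (by simpa using Ne.symm hb.1) (hnbr' _ a fun v hav => by
    rw [Finset.mem_compl, Finset.mem_singleton]
    rintro rfl
    exact hb.2 hav)
  rwa [← Finset.compl_insert] at h

end ListColoring

/-! ### Arithmetic of the Heawood number -/

theorem six_le_heawood {ε : ℕ} (hε : 0 < ε) : 6 ≤ heawood ε := by
  refine Nat.le_floor ?_
  have h1 : (1 : ℝ) ≤ ε := by exact_mod_cast hε
  have h2 : (5 : ℝ) ≤ Real.sqrt (24 * (ε : ℝ) + 1) := Real.le_sqrt_of_sq_le (by linarith)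
  push_cast
  linarith

theorem lt_heawood_mul {ε : ℕ} (hε : 0 < ε) :
    6 * ε + 5 * heawood ε < heawood ε * heawood ε + 6 := by
  have h6 : (6 : ℝ) ≤ heawood ε := by exact_mod_cast six_le_heawood hε
  have h1 : (7 + Real.sqrt (24 * (ε : ℝ) + 1)) / 2 < heawood ε + 1 := Nat.lt_floor_add_one _
  have h2 : Real.sqrt (24 * (ε : ℝ) + 1) < 2 * heawood ε - 5 := by linarith
  rw [Real.sqrt_lt' (by linarith)] at h2
  have h3 : (6 * ε + 5 * heawood ε : ℝ) < heawood ε * heawood ε + 6 := by nlinarith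
  exact_mod_cast h3

/-- Outside the special values of the Euler genus, `6 ε ≤ H (H - 5)`. -/
theorem le_heawood_mul {ε : ℕ} (hε : 0 < ε)
    (hspecial : ∀ i : ℕ, 1 ≤ i → 2 * ε ≠ 3 * i ^ 2 + 3 * i) :
    6 * ε + 5 * heawood ε ≤ heawood ε * heawood ε := by
  have h1 := lt_heawood_mul hε
  have h2 := six_le_heawood hε
  generalize heawood ε = H at h1 h2 ⊢
  obtain ⟨q, r, hr, rfl⟩ : ∃ q r, r < 3 ∧ H = 3 * q + r :=
    ⟨H / 3, H % 3, Nat.mod_lt _ (by norm_num), (Nat.div_add_mod H 3).symm⟩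
  -- `H (H - 5)` is even, and divisible by 3 unless `H = 3 q + 1`. In that case `6 ε = H (H - 5) +
  -- 4` is the only way to fail; with `H = 3 i + 4` it reads `2 ε = 3 i ^ 2 + 3 i`, a special value.
  obtain ⟨i, rfl⟩ : ∃ i, q = i + 1 := ⟨q - 1, by omega⟩
  have h3 := hspecial i (by omega)
  obtain ⟨t, ht⟩ := Nat.even_mul_succ_self i
  interval_cases r <;> ring_nf at * <;> omega

/-! ### Excluding a minimal uncolourable graph -/

open scoped Classical in
/-- There is no minimal uncolourable graph with lists as in the main theorem. -/
theorem SurfaceEmbedding.not_critical {V Φ C : Type*} [Fintype V] [Nonempty V] [Finite Φ]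
    {G : SimpleGraph V} {S : CellSurface Φ} (E : SurfaceEmbedding G S) (F : E.Face)
    {ε H : ℕ} (hS : S.eulerGenus = ε) (hH : 6 ≤ H) (hHε : 6 * ε + 5 * H ≤ H * H)
    {L : V → Finset C} {U : Set V} (hU : U ⊆ E.faceVerts F) (hL : ∀ v, H - 2 ≤ (L v).card)
    (hL' : ∀ v ∉ U, H ≤ (L v).card)
    (hK : ¬ ∃ K : Finset V, G.IsNClique (H - 1) K ∧ ∀ v ∈ K, v ∈ U) (c₀ : V → C)
    (hcrit : ∀ Y ⊂ Finset.univ, ListColorableOn G L Y) : ListColorableOn G L Finset.univ := by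
  by_contra hcol
  have := Fintype.ofFinite Φ
  have hdeg : ∀ v, (L v).card ≤ (Finset.univ.filter (G.Adj v)).card := fun v =>
    card_le_degree_of_critical hcol hcrit (Finset.mem_univ v)
  have hdeg_lt : ∀ v, (Finset.univ.filter (G.Adj v)).card < Fintype.card V := fun v =>
    Finset.card_lt_card (t := Finset.univ)
      ⟨Finset.subset_univ _, fun h => by simpa using h (Finset.mem_univ v)⟩
  rcases le_or_gt (Fintype.card V) H with hn | hn
  · have hUall : ∀ v, v ∈ U := by
      intro v
      by_contra hv
      have h1 := hL' v hv
      have h2 := hdeg v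
      have h3 := hdeg_lt v
      omega
    obtain ⟨v₀⟩ := ‹Nonempty V›
    rcases (show Fintype.card V = H - 1 ∨ Fintype.card V = (H - 2) + 2 by
      have h1 := hL v₀
      have h2 := hdeg v₀
      have h3 := hdeg_lt v₀
      omega) with hn' | hn'
    · refine hK ⟨Finset.univ, ⟨?_, hn'⟩, fun v _ => hUall v⟩
      intro a _ b _ hab
      by_contra hnab
      have h1 : Finset.univ.filter (G.Adj a) ⊆ ({a, b} : Finset V)ᶜ := by
        intro t ht
        simp only [Finset.mem_filter, Finset.mem_univ, true_and] at ht
        simp only [Finset.mem_compl, Finset.mem_insert, Finset.mem_singleton, not_or]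
        exact ⟨ht.ne', by rintro rfl; exact hnab ht⟩
      have h2 := Finset.card_le_card h1
      rw [Finset.card_compl, Finset.card_pair hab] at h2
      have h3 := hdeg a
      have h4 := hL a
      omega
    · refine hcol (listColorableOn_of_card_eq_add_two hn'
        (fun v => (hL v).trans (hdeg v)) hL ?_ c₀)
      rintro ⟨K, hKc⟩
      rw [show H - 2 + 1 = H - 1 by omega] at hKc
      exact hK ⟨K, hKc, fun v _ => hUall v⟩
  · have hnbr : ∀ v, ∃ a b, a ≠ b ∧ G.Adj v a ∧ G.Adj v b := by
      intro v
      obtain ⟨a, ha, b, hb, hab⟩ := Finset.one_lt_card.1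
        (show 1 < (Finset.univ.filter (G.Adj v)).card by
          have h1 := hL v
          have h2 := hdeg v
          omega)
      exact ⟨a, b, hab, by simpa using ha, by simpa using hb⟩
    have hnbr' : ∀ v, ∃ a, G.Adj v a := fun v => by
      obtain ⟨a, -, -, ha, -⟩ := hnbr v
      exact ⟨a, ha⟩
    have : Nontrivial G.edgeSet := by
      obtain ⟨v⟩ := ‹Nonempty V›
      obtain ⟨a, b, hab, ha, hb⟩ := hnbr v
      exact ⟨⟨s(v, a), ha⟩, ⟨s(v, b), hb⟩, fun h => hab (Sym2.congr_right.1 (Subtype.mk.inj h))⟩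
    have hbound := E.card_edges_add_card_faceVerts_le hnbr' F
    have hle : ∀ v ∈ Finset.univ, H ≤
        (Finset.univ.filter (G.Adj v)).card + if v ∈ E.faceVerts F then 2 else 0 := by
      intro v _
      have h1 := hdeg v
      split_ifs with hv
      · have h2 := hL v
        omega
      · exact (hL' v fun h => hv (hU h)).trans h1
    have hsum := Finset.sum_le_sum (f := fun _ => H) hle
    have hsumi := Finset.sum_eq_sum_iff_of_le (f := fun _ => H) hle
    have hdegsum : ∑ v, (Finset.univ.filter (G.Adj v)).card = 2 * G.edgeFinset.card := by
      rw [← G.sum_degrees_eq_twice_card_edges]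
      refine Finset.sum_congr rfl fun v _ => ?_
      rw [← G.card_neighborFinset_eq_degree, G.neighborFinset_eq_filter]
    rw [Finset.sum_add_distrib, hdegsum, ← Finset.sum_filter, Finset.sum_const, Finset.sum_const,
      Finset.card_univ, smul_eq_mul, smul_eq_mul] at hsum hsumi
    rw [hS] at hbound
    -- With `n ≥ H + 1` one has `(H - 6) n ≥ (H - 6) (H + 1) = H (H - 5) - 6 ≥ 6 ε - 6`. Together
    -- with `hsum` and `hbound` this makes every estimate an equality.
    have hmul : 6 * Fintype.card V + 6 * ε ≤ Fintype.card V * H + 6 := by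
      obtain ⟨p, hp⟩ := Nat.exists_eq_add_of_le hH
      obtain ⟨q, hq⟩ := Nat.exists_eq_add_of_lt hn
      rw [hq]
      subst hp
      nlinarith [Nat.zero_le (p * q)]
    have heq := hsumi.1 (by omega)
    have htight : 6 * Fintype.card V - 6 + 6 * S.eulerGenus ≤
        2 * (G.edgeFinset.card + (Finset.univ.filter (· ∈ E.faceVerts F)).card : ℤ) := by
      rw [hS]
      omega
    have hLdeg : ∀ v, (Finset.univ.filter (G.Adj v)).card ≤ (L v).card := by
      intro v
      have h1 := heq v (Finset.mem_univ v)
      split_ifs at h1 with hv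
      · have h2 := hL v
        omega
      · have h2 := hL' v fun h => hv (hU h)
        omega
    have hconn := connectedOn_of_critical hcol hcrit
    refine hcol (hconn.listColorableOn_of_connected_neighborhoods
      (exists_adj_between_neighbors_of_tight hnbr' F htight) hLdeg ?_ ?_)
    · intro a b z
      have h1 := hL a
      have h2 := hL b
      have h3 := hdeg z
      have h4 := heq z (Finset.mem_univ z)
      omega
    -- A vertex on the face has degree exactly `H - 2`, too small for a complete graph on more than
    -- `H` vertices.
    · obtain ⟨w, hw⟩ := exists_mem_faceVerts F
      have h1 := heq w (Finset.mem_univ w)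
      rw [if_pos hw] at h1
      by_contra! hcomplete
      have h2 : Finset.univ.filter (G.Adj w) = Finset.univ.erase w := by
        ext t
        simp only [Finset.mem_filter, Finset.mem_univ, true_and, Finset.mem_erase, and_true]
        exact ⟨fun h => h.ne', fun h => hcomplete w t h.symm⟩
      rw [h2, Finset.card_erase_of_mem (Finset.mem_univ w), Finset.card_univ] at h1
      omega

/-- If `2 ε ≠ 3 i² + 3 i` for all `i ≥ 1` and the finite graph `G` is embedded on a surface `S` of
Euler genus `ε ≥ 1` with a distinguished face `F`, if the vertices on `F` have lists of at least
`H(ε) - 2` colors and the others have lists of at least `H(ε)` colors, then `G` is list-colorable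
unless `G` contains a complete graph on `H(ε) - 1` vertices, all of them on `F`. -/
theorem proposition3p3 (ε : ℕ) (hε : 0 < ε)
    (hspecial : ∀ i : ℕ, 1 ≤ i → 2 * ε ≠ 3 * i ^ 2 + 3 * i)
    {V Φ C : Type*} [Finite V] (G : SimpleGraph V)
    (S : CellSurface Φ) (hS : S.eulerGenus = (ε : ℤ))
    (E : SurfaceEmbedding G S) (F : E.Face)
    (L : V → Finset C)
    (hF : ∀ v ∈ E.faceVerts F, heawood ε - 2 ≤ (L v).card)
    (hL : ∀ v ∉ E.faceVerts F, heawood ε ≤ (L v).card)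
    (hK : ¬ ∃ K : Finset V, G.IsNClique (heawood ε - 1) K ∧ ∀ v ∈ K, v ∈ E.faceVerts F) :
    ListColorable G L := by
  classical
  have := Fintype.ofFinite V
  have := S.finite_flags
  have hH := six_le_heawood hε
  have hL₂ : ∀ v, heawood ε - 2 ≤ (L v).card := by
    intro v
    by_cases hv : v ∈ E.faceVerts F
    · exact hF v hv
    · exact (Nat.sub_le _ _).trans (hL v hv)
  have hne : ∀ v, (L v).Nonempty := fun v => Finset.card_pos.1 (by have := hL₂ v; omega)
  choose c₀ hc₀ using hne
  suffices h : ListColorableOn G L Finset.univ by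
    obtain ⟨c, hc, hadj⟩ := h
    exact ⟨SimpleGraph.Coloring.mk c fun {u v} huv =>
      hadj u (Finset.mem_univ u) v (Finset.mem_univ v) huv, fun v => hc v (Finset.mem_univ v)⟩
  by_contra hcol
  obtain ⟨X, -, hX⟩ := exists_minimal_le_of_wellFoundedLT
    (fun X : Finset V => ¬ ListColorableOn G L X) Finset.univ hcol
  -- Naming the face by a flag lets it be followed to the induced embedding. The face there may
  -- carry more vertices, so the set `U` of short-list vertices is kept separately.
  obtain ⟨x, rfl⟩ : ∃ x, E.faceOf x = F := Quotient.exists_rep F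
  have hXne : X.Nonempty := by
    rw [Finset.nonempty_iff_ne_empty]
    rintro rfl
    exact hX.prop ⟨c₀, by simp, by simp⟩
  have : Nonempty (X : Set V) := hXne.to_subtype
  have key := (E.induce X).not_critical ((E.induce X).faceOf x) hS hH (le_heawood_mul hε hspecial)
    (L := fun v => L v) (U := {v | v.1 ∈ E.faceVerts (E.faceOf x)})
    (fun v hv => SurfaceEmbedding.mem_faceVerts_induce (E := E) (X : Set V) (v := v) (x := x) hv)
    (fun v => hL₂ v) (fun v hv => hL v hv)
    (by
      rintro ⟨K, hKc, hKF⟩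
      refine hK ⟨K.map (Function.Embedding.subtype _), ⟨?_, ?_⟩, ?_⟩
      · intro a ha b hb hab
        obtain ⟨a', ha', rfl⟩ := Finset.mem_map.1 (Finset.mem_coe.1 ha)
        obtain ⟨b', hb', rfl⟩ := Finset.mem_map.1 (Finset.mem_coe.1 hb)
        exact hKc.isClique ha' hb' fun h => hab (congrArg _ h)
      · rw [Finset.card_map, hKc.card_eq]
      · intro v hv
        obtain ⟨v', hv', rfl⟩ := Finset.mem_map.1 hv
        exact hKF v' hv')
    (fun v => c₀ v)
    (by
      intro Y hY
      rw [listColorableOn_induce_iff _ _ c₀]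
      by_contra hYcol
      have hsub : Y.map (Function.Embedding.subtype _) ⊆ X := by
        intro v hv
        obtain ⟨v, -, rfl⟩ := Finset.mem_map.1 hv
        exact v.2
      refine hY.2 fun v _ => ?_
      obtain ⟨w, hw, hwv⟩ := Finset.mem_map.1 (hX.le_of_le hYcol hsub v.2)
      rwa [← Subtype.ext hwv])
  rw [listColorableOn_induce_iff _ _ c₀] at key
  refine hX.prop (key.mono fun v hv => ?_)
  exact Finset.mem_map.2 ⟨⟨v, hv⟩, Finset.mem_univ _, rfl⟩
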